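/- Let $X$ be a compact space and $H$ a complex Hilbert space (for instance the separable infinite-dimensional one). Write $\mathcal K(H)$ for the algebra of compact operators on $H$ and $PU(H)=U(H)/S^1$ for the projective unitary group, with the quotient of the strong operator topology (so that cocycles which are continuous for the norm topology are allowed a fortiori). Let $\mathcal A$ be a bundle of algebras on $X$ with fibre $\mathcal K(H)$ and structural group $PU(H)$, given by an open covering $(U_i)$ of $X$ and a cocycle of continuous functions $g_{ji}\colon U_i\cap U_j\to PU(H)$. For $n\ge 0$ let $H^{\otimes n}$ be the Hilbert space tensor power, and let $\mathcal A^{\otimes n}$ be the bundle with fibre $\mathcal K(H^{\otimes n})$ whose cocycle is the image of $(g_{ji})$ under the diagonal homomorphism $PU(H)\to PU(H^{\otimes n})$ induced by $u\mapsto u^{\otimes n}=u\otimes\cdots\otimes u$. The symmetric group $S_n$ acts on $\mathcal A^{\otimes n}$, over the identity of $X$, by permutation of the factors: in each fibre, $\sigma$ acts by conjugation by the class in $PU(H^{\otimes n})$ of the operator $x_1\otimes\cdots\otimes x_n\mapsto x_{\sigma^{-1}(1)}\otimes\cdots\otimes x_{\sigma^{-1}(n)}$. For a finite group $G$ acting by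 automorphisms on a unital complex Banach algebra $B$, let $K_G(B)$ be the Grothendieck group (for direct sums) of the finitely generated projective left $B$-modules $E$ with an action of $G$ such that $g(be)=(gb)(ge)$. For $B$ not necessarily unital put $K_G(B)=\operatorname{Ker}\bigl(K_G(B^+)\to K_G(\mathbb C)\bigr)$, where $B^+$ is $B$ with a unit added, the map is extension of scalars along the augmentation $B^+\to\mathbb C$, and $G$ acts trivially on $\mathbb C$. Let $K_{S_n}^{(\mathcal A^{\otimes n})}(X)$ be $K_{S_n}(\Gamma(X,\mathcal A^{\otimes n}))$, where $\Gamma(X,\mathcal A^{\otimes n})$ is the algebra of continuous sections with the above action of $S_n$, and let $K_{S_n}^{(\mathcal A^{\otimes n})_0}(X)$ be the same group formed with the trivial action of $S_n$ on $\Gamma(X,\mathcal A^{\otimes n})$. Then there is an isomorphism of abelian groups $$K_{S_n}^{(\mathcal A^{\otimes n})}(X)\;\cong\;K_{S_n}^{(\mathcal A^{\otimes n})_0}(X).$$ Moreover, the permutation representation $S_n\to PU(H^{\otimes n})$ lifts to a group homomorphism $\rho\colon S_n\to U(H^{\otimes n})$ such that $\rho(\sigma)\,u^{\otimes n}=u^{\otimes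 n}\,\rho(\sigma)$ for all $\sigma\in S_n$ and $u\in U(H)$. -/

import Mathlib

open scoped TensorProduct

universe u v w

namespace TwistedK

noncomputable section

/-! ### Hilbert tensor powers -/

/-- The algebraic tensor power `H ⊗ ⋯ ⊗ H` (`n` factors), as a type of its own so that it can carry
the Hilbert space inner product. -/
def AlgTensorPower (H : Type v) [NormedAddCommGroup H] [InnerProductSpace ℂ H] (n : ℕ) : Type v :=
  ⨂[ℂ] _ : Fin n, H

section TensorPower

variable {H : Type v} [NormedAddCommGroup H] [InnerProductSpace ℂ H] {n : ℕ}

instance : AddCommGroup (AlgTensorPower H n) :=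
  inferInstanceAs (AddCommGroup (⨂[ℂ] _ : Fin n, H))

instance : Module ℂ (AlgTensorPower H n) :=
  inferInstanceAs (Module ℂ (⨂[ℂ] _ : Fin n, H))

/-- The elementary tensor `x₁ ⊗ ⋯ ⊗ xₙ`, as a multilinear map. -/
def AlgTensorPower.tprod : MultilinearMap ℂ (fun _ : Fin n => H) (AlgTensorPower H n) :=
  PiTensorProduct.tprod ℂ

/-- Linear maps out of the algebraic tensor power. -/
def AlgTensorPower.lift {E : Type*} [AddCommGroup E] [Module ℂ E]
    (φ : MultilinearMap ℂ (fun _ : Fin n => H) E) : AlgTensorPower H n →ₗ[ℂ] E :=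
  PiTensorProduct.lift φ

@[simp] theorem AlgTensorPower.lift_tprod {E : Type*} [AddCommGroup E] [Module ℂ E]
    (φ : MultilinearMap ℂ (fun _ : Fin n => H) E) (x : Fin n → H) :
    AlgTensorPower.lift φ (AlgTensorPower.tprod x) = φ x :=
  PiTensorProduct.lift.tprod x

theorem AlgTensorPower.ext {E : Type*} [AddCommGroup E] [Module ℂ E]
    {f g : AlgTensorPower H n →ₗ[ℂ] E}
    (h : ∀ x : Fin n → H, f (AlgTensorPower.tprod x) = g (AlgTensorPower.tprod x)) : f = g :=
  PiTensorProduct.ext (MultilinearMap.ext h)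

theorem AlgTensorPower.span_tprod :
    Submodule.span ℂ (Set.range (AlgTensorPower.tprod (H := H) (n := n))) = ⊤ :=
  PiTensorProduct.span_tprod_eq_top

/-- The linear form `y₁ ⊗ ⋯ ⊗ yₙ ↦ ∏ i, ⟪xᵢ, yᵢ⟫`. -/
def AlgTensorPower.pair (x : Fin n → H) : AlgTensorPower H n →ₗ[ℂ] ℂ :=
  AlgTensorPower.lift
    ((MultilinearMap.mkPiAlgebra ℂ (Fin n) ℂ).compLinearMap fun i => (innerₛₗ ℂ (x i)))

@[simp] theorem AlgTensorPower.pair_tprod (x y : Fin n → H) :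
    AlgTensorPower.pair x (AlgTensorPower.tprod y) = ∏ i, inner ℂ (x i) (y i) := by
  simp [AlgTensorPower.pair]

theorem AlgTensorPower.prod_update (x y : Fin n → H) (i : Fin n) (c : H) :
    (∏ k, inner ℂ (Function.update x i c k) (y k))
      = inner ℂ c (y i) * ∏ k ∈ Finset.univ.erase i, inner ℂ (x k) (y k) := by
  rw [← Finset.mul_prod_erase _ _ (Finset.mem_univ i)]
  congr 1
  · simp
  · refine Finset.prod_congr rfl fun k hk => ?_
    rw [Function.update_of_ne (Finset.ne_of_mem_erase hk)]

/-- For fixed `t`, the linear form `x₁ ⊗ ⋯ ⊗ xₙ ↦ conj (pair x t)`. -/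
def AlgTensorPower.copair (t : AlgTensorPower H n) : AlgTensorPower H n →ₗ[ℂ] ℂ :=
  AlgTensorPower.lift
    { toFun := fun x => starRingEnd ℂ (AlgTensorPower.pair x t)
      map_update_add' := by
        intro inst x i a b
        obtain rfl : inst = instDecidableEqFin n := Subsingleton.elim _ _
        have : AlgTensorPower.pair (Function.update x i (a + b))
            = AlgTensorPower.pair (Function.update x i a)
              + AlgTensorPower.pair (Function.update x i b) := by
          refine AlgTensorPower.ext fun y => ?_
          simp only [AlgTensorPower.pair_tprod, LinearMap.add_apply, AlgTensorPower.prod_update,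
            inner_add_left, add_mul]
        simp [this]
      map_update_smul' := by
        intro inst x i c a
        obtain rfl : inst = instDecidableEqFin n := Subsingleton.elim _ _
        have : AlgTensorPower.pair (Function.update x i (c • a))
            = starRingEnd ℂ c • AlgTensorPower.pair (Function.update x i a) := by
          refine AlgTensorPower.ext fun y => ?_
          simp only [AlgTensorPower.pair_tprod, LinearMap.smul_apply, AlgTensorPower.prod_update,
            inner_smul_left, smul_eq_mul, mul_assoc]
        simp [this] }

/-- The inner product: `⟪x₁ ⊗ ⋯ ⊗ xₙ, y₁ ⊗ ⋯ ⊗ yₙ⟫ = ∏ i, ⟪xᵢ, yᵢ⟫`. -/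
instance : Inner ℂ (AlgTensorPower H n) :=
  ⟨fun s t => starRingEnd ℂ (AlgTensorPower.copair t s)⟩

theorem AlgTensorPower.inner_def (s t : AlgTensorPower H n) :
    inner ℂ s t = starRingEnd ℂ (AlgTensorPower.copair t s) := rfl

theorem AlgTensorPower.inner_tprod_left (x : Fin n → H) (t : AlgTensorPower H n) :
    inner ℂ (AlgTensorPower.tprod x) t = AlgTensorPower.pair x t := by
  simp [AlgTensorPower.inner_def, AlgTensorPower.copair]

theorem AlgTensorPower.inner_tprod_tprod (x y : Fin n → H) :
    inner ℂ (AlgTensorPower.tprod x) (AlgTensorPower.tprod y) = ∏ i, inner ℂ (x i) (y i) := by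
  rw [AlgTensorPower.inner_tprod_left, AlgTensorPower.pair_tprod]

theorem AlgTensorPower.inner_add_left' (s s' t : AlgTensorPower H n) :
    inner ℂ (s + s') t = inner ℂ s t + inner ℂ s' t := by
  simp [AlgTensorPower.inner_def]

theorem AlgTensorPower.inner_smul_left' (c : ℂ) (s t : AlgTensorPower H n) :
    inner ℂ (c • s) t = starRingEnd ℂ c * inner ℂ s t := by
  simp [AlgTensorPower.inner_def]

theorem AlgTensorPower.inner_sum_left' {κ : Type*} (S : Finset κ) (f : κ → AlgTensorPower H n)
    (t : AlgTensorPower H n) : inner ℂ (∑ a ∈ S, f a) t = ∑ a ∈ S, inner ℂ (f a) t := by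
  simp [AlgTensorPower.inner_def]

theorem AlgTensorPower.exists_sum (t : AlgTensorPower H n) :
    ∃ (m : ℕ) (c : Fin m → ℂ) (x : Fin m → Fin n → H),
      t = ∑ a, c a • AlgTensorPower.tprod (x a) := by
  have ht : t ∈ Submodule.span ℂ (Set.range (AlgTensorPower.tprod (H := H) (n := n))) := by
    rw [AlgTensorPower.span_tprod]; trivial
  obtain ⟨m, c, g, hg⟩ := Submodule.mem_span_set'.1 ht
  choose x hx using fun a => (g a).2
  exact ⟨m, c, x, by rw [← hg]; simp [hx]⟩

theorem AlgTensorPower.inner_sum_sum {m : ℕ} (c : Fin m → ℂ) (x : Fin m → Fin n → H)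
    {m' : ℕ} (c' : Fin m' → ℂ) (x' : Fin m' → Fin n → H) :
    inner ℂ (∑ a, c a • AlgTensorPower.tprod (x a)) (∑ b, c' b • AlgTensorPower.tprod (x' b))
      = ∑ a, ∑ b, starRingEnd ℂ (c a) * c' b * ∏ i, inner ℂ (x a i) (x' b i) := by
  simp only [AlgTensorPower.inner_sum_left', AlgTensorPower.inner_smul_left',
    AlgTensorPower.inner_tprod_left, map_sum, map_smul, AlgTensorPower.pair_tprod, smul_eq_mul,
    Finset.mul_sum, mul_assoc]

open scoped ComplexOrder in
theorem AlgTensorPower.posSemidef_prod {m : ℕ} (x : Fin m → Fin n → H) (S : Finset (Fin n)) :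
    (Matrix.of fun a b => ∏ i ∈ S, inner ℂ (x a i) (x b i)).PosSemidef := by
  classical
  induction S using Finset.induction_on with
  | empty =>
    have : (Matrix.of fun _ _ : Fin m => (1 : ℂ)) = Matrix.gram ℂ (fun _ : Fin m => (1 : ℂ)) := by
      ext; simp [Matrix.gram]
    simp only [Finset.prod_empty]
    rw [this]
    exact Matrix.posSemidef_gram ℂ _
  | insert i S hi ih =>
    have h := (Matrix.posSemidef_gram ℂ (fun a => x a i)).hadamard ih
    have e : (Matrix.of fun a b => ∏ j ∈ insert i S, inner ℂ (x a j) (x b j))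
        = (Matrix.gram ℂ fun a => x a i).hadamard
          (Matrix.of fun a b => ∏ j ∈ S, inner ℂ (x a j) (x b j)) := by
      ext a b
      simp [Finset.prod_insert hi]
    rw [e]
    exact h

open scoped ComplexOrder in
/-- The inner product of the algebraic tensor power satisfies the axioms. (It is also definite, but
this is not needed in order to complete.) -/
@[reducible] def AlgTensorPower.core : PreInnerProductSpace.Core ℂ (AlgTensorPower H n) where
  conj_inner_symm s t := by
    obtain ⟨m, c, x, rfl⟩ := AlgTensorPower.exists_sum s
    obtain ⟨m', c', x', rfl⟩ := AlgTensorPower.exists_sum t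
    rw [AlgTensorPower.inner_sum_sum, AlgTensorPower.inner_sum_sum, Finset.sum_comm]
    simp only [map_sum, map_mul, map_prod, inner_conj_symm, RingHomCompTriple.comp_apply,
      RingHom.id_apply]
    refine Finset.sum_congr rfl fun a _ => Finset.sum_congr rfl fun b _ => ?_
    ring
  re_inner_nonneg t := by
    obtain ⟨m, c, x, rfl⟩ := AlgTensorPower.exists_sum t
    rw [AlgTensorPower.inner_sum_sum]
    have h := (AlgTensorPower.posSemidef_prod x Finset.univ).re_dotProduct_nonneg c
    convert h using 2
    simp only [dotProduct, Matrix.mulVec, Finset.mul_sum, Matrix.of_apply, Pi.star_apply,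
      RCLike.star_def]
    refine Finset.sum_congr rfl fun a _ => Finset.sum_congr rfl fun b _ => ?_
    ring
  add_left := AlgTensorPower.inner_add_left'
  smul_left s t c := AlgTensorPower.inner_smul_left' c s t

instance : SeminormedAddCommGroup (AlgTensorPower H n) :=
  @InnerProductSpace.Core.toSeminormedAddCommGroup ℂ _ _ _ _ AlgTensorPower.core

instance : InnerProductSpace ℂ (AlgTensorPower H n) :=
  InnerProductSpace.ofCore AlgTensorPower.core

/-- The seminorm of an elementary tensor is the product of the norms. -/
theorem AlgTensorPower.norm_tprod (x : Fin n → H) :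
    ‖(AlgTensorPower.tprod x : AlgTensorPower H n)‖ = ∏ i, ‖x i‖ := by
  have h := inner_self_eq_norm_sq_to_K (𝕜 := ℂ) (AlgTensorPower.tprod x : AlgTensorPower H n)
  rw [AlgTensorPower.inner_tprod_tprod] at h
  simp only [inner_self_eq_norm_sq_to_K, Finset.prod_pow] at h
  have h2 : (∏ i, ‖x i‖) ^ 2 = ‖(AlgTensorPower.tprod x : AlgTensorPower H n)‖ ^ 2 := by
    exact_mod_cast h
  exact ((sq_eq_sq₀ (Finset.prod_nonneg fun i _ => norm_nonneg _) (norm_nonneg _)).1 h2).symm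


/-- The `n`-fold Hilbert space tensor power `H^{⊗n}`: the completion of the algebraic one. -/
abbrev TensorPower (H : Type v) [NormedAddCommGroup H] [InnerProductSpace ℂ H] (n : ℕ) : Type v :=
  UniformSpace.Completion (AlgTensorPower H n)

/-- The elementary tensor `x₁ ⊗ ⋯ ⊗ xₙ` in `H^{⊗n}`. -/
def TensorPower.tprod (x : Fin n → H) : TensorPower H n :=
  ((AlgTensorPower.tprod x : AlgTensorPower H n) : UniformSpace.Completion (AlgTensorPower H n))

theorem TensorPower.inner_tprod (x y : Fin n → H) :
    inner ℂ (TensorPower.tprod x) (TensorPower.tprod y) = ∏ i, inner ℂ (x i) (y i) := by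
  rw [TensorPower.tprod, TensorPower.tprod, UniformSpace.Completion.inner_coe,
    AlgTensorPower.inner_tprod_tprod]

theorem TensorPower.continuous_tprod :
    Continuous (TensorPower.tprod : (Fin n → H) → TensorPower H n) :=
  (UniformSpace.Completion.continuous_coe _).comp
    (MultilinearMap.continuous_of_bound (AlgTensorPower.tprod (H := H) (n := n)) 1 fun x => by
      rw [AlgTensorPower.norm_tprod, one_mul])

/-- Induction principle: a closed set that is stable under linear combinations and contains the
elementary tensors is everything. -/
theorem TensorPower.induction {p : TensorPower H n → Prop} (t : TensorPower H n)
    (hc : IsClosed {t | p t}) (h0 : p 0) (hadd : ∀ s t, p s → p t → p (s + t))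
    (hsmul : ∀ (c : ℂ) s, p s → p (c • s)) (h : ∀ x, p (TensorPower.tprod x)) : p t := by
  refine UniformSpace.Completion.induction_on t hc fun s => ?_
  have hs : s ∈ Submodule.span ℂ (Set.range (AlgTensorPower.tprod (H := H) (n := n))) := by
    rw [AlgTensorPower.span_tprod]; trivial
  induction hs using Submodule.span_induction with
  | mem _ hx => obtain ⟨x, rfl⟩ := hx; exact h x
  | zero => rw [UniformSpace.Completion.coe_zero]; exact h0
  | add a b _ _ ha hb => rw [UniformSpace.Completion.coe_add]; exact hadd _ _ ha hb
  | smul c a _ ha => rw [UniformSpace.Completion.coe_smul]; exact hsmul c _ ha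

theorem TensorPower.clm_ext {f g : TensorPower H n →L[ℂ] TensorPower H n}
    (h : ∀ x : Fin n → H, f (TensorPower.tprod x) = g (TensorPower.tprod x)) : f = g := by
  refine ContinuousLinearMap.ext fun t => ?_
  refine TensorPower.induction t (isClosed_eq f.continuous g.continuous) ?_ ?_ ?_ h
  · rw [map_zero, map_zero]
  · intro s t hs ht
    rw [map_add, map_add, hs, ht]
  · intro c s hs
    rw [map_smul, map_smul, hs]

theorem TensorPower.unitary_ext {u u' : unitary (TensorPower H n →L[ℂ] TensorPower H n)}
    (h : ∀ x : Fin n → H, (u : TensorPower H n →L[ℂ] TensorPower H n) (TensorPower.tprod x)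
      = (u' : TensorPower H n →L[ℂ] TensorPower H n) (TensorPower.tprod x)) : u = u' :=
  Subtype.ext (TensorPower.clm_ext h)

theorem AlgTensorPower.norm_map_eq (f : AlgTensorPower H n ≃ₗ[ℂ] AlgTensorPower H n)
    (hf : ∀ x y : Fin n → H, inner ℂ (f (AlgTensorPower.tprod x)) (f (AlgTensorPower.tprod y))
      = inner ℂ (AlgTensorPower.tprod x) (AlgTensorPower.tprod y)) (t : AlgTensorPower H n) :
    ‖UniformSpace.Completion.toComplₗᵢ (𝕜 := ℂ) (f t)‖
      = ‖UniformSpace.Completion.toComplₗᵢ (𝕜 := ℂ) t‖ := by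
  have key : inner ℂ (f t) (f t) = inner ℂ t t := by
    obtain ⟨m, c, x, rfl⟩ := AlgTensorPower.exists_sum t
    simp only [map_sum, map_smul, sum_inner, inner_sum, inner_smul_left, inner_smul_right, hf]
  have h2 : ‖f t‖ = ‖t‖ := by
    rw [@norm_eq_sqrt_re_inner ℂ, @norm_eq_sqrt_re_inner ℂ _ _ _ _ t, key]
  simpa using h2

/-- A linear automorphism of the algebraic tensor power that preserves the inner products of
elementary tensors extends to a unitary operator on `H^{⊗n}`. -/
def TensorPower.extend (f : AlgTensorPower H n ≃ₗ[ℂ] AlgTensorPower H n)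
    (hf : ∀ x y : Fin n → H, inner ℂ (f (AlgTensorPower.tprod x)) (f (AlgTensorPower.tprod y))
      = inner ℂ (AlgTensorPower.tprod x) (AlgTensorPower.tprod y)) :
    unitary (TensorPower H n →L[ℂ] TensorPower H n) :=
  Unitary.linearIsometryEquiv.symm
    (f.extendOfIsometry
      (UniformSpace.Completion.toComplₗᵢ (𝕜 := ℂ) (E := AlgTensorPower H n)).toLinearMap
      (UniformSpace.Completion.toComplₗᵢ (𝕜 := ℂ) (E := AlgTensorPower H n)).toLinearMap
      UniformSpace.Completion.denseRange_coe UniformSpace.Completion.denseRange_coe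
      (AlgTensorPower.norm_map_eq f hf))

theorem TensorPower.extend_coe (f : AlgTensorPower H n ≃ₗ[ℂ] AlgTensorPower H n)
    (hf : ∀ x y : Fin n → H, inner ℂ (f (AlgTensorPower.tprod x)) (f (AlgTensorPower.tprod y))
      = inner ℂ (AlgTensorPower.tprod x) (AlgTensorPower.tprod y)) (t : AlgTensorPower H n) :
    (TensorPower.extend f hf : TensorPower H n →L[ℂ] TensorPower H n)
      (t : UniformSpace.Completion (AlgTensorPower H n)) = ((f t : AlgTensorPower H n) : _) :=
  LinearEquiv.extendOfIsometry_eq f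
    (UniformSpace.Completion.toComplₗᵢ (𝕜 := ℂ) (E := AlgTensorPower H n)).toLinearMap
    (UniformSpace.Completion.toComplₗᵢ (𝕜 := ℂ) (E := AlgTensorPower H n)).toLinearMap
    UniformSpace.Completion.denseRange_coe UniformSpace.Completion.denseRange_coe
    (AlgTensorPower.norm_map_eq f hf) t

/-- The permutation representation of the symmetric group on `H^{⊗n}`,
`σ (x₁ ⊗ ⋯ ⊗ xₙ) = x_{σ⁻¹ 1} ⊗ ⋯ ⊗ x_{σ⁻¹ n}`, by unitary operators. -/
def permUnitary (H : Type v) [NormedAddCommGroup H] [InnerProductSpace ℂ H] (n : ℕ)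
    (σ : Equiv.Perm (Fin n)) : unitary (TensorPower H n →L[ℂ] TensorPower H n) :=
  TensorPower.extend (PiTensorProduct.reindex ℂ (fun _ : Fin n => H) σ) fun x y => by
    have h : ∀ x : Fin n → H, (PiTensorProduct.reindex ℂ (fun _ : Fin n => H) σ)
        (AlgTensorPower.tprod x) = AlgTensorPower.tprod fun i => x (σ.symm i) :=
      fun x => PiTensorProduct.reindex_tprod σ x
    erw [h, h]
    rw [AlgTensorPower.inner_tprod_tprod, AlgTensorPower.inner_tprod_tprod]
    exact Equiv.prod_comp σ.symm fun i => inner ℂ (x i) (y i)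

theorem permUnitary_tprod (σ : Equiv.Perm (Fin n)) (x : Fin n → H) :
    (permUnitary H n σ : TensorPower H n →L[ℂ] TensorPower H n) (TensorPower.tprod x)
      = TensorPower.tprod fun i => x (σ⁻¹ i) := by
  refine (TensorPower.extend_coe _ _ _).trans ?_
  exact congrArg _ (PiTensorProduct.reindex_tprod σ x)

theorem permUnitary_one : permUnitary H n 1 = 1 :=
  TensorPower.unitary_ext fun x => by simp [permUnitary_tprod]

theorem permUnitary_mul (σ τ : Equiv.Perm (Fin n)) :
    permUnitary H n (σ * τ) = permUnitary H n σ * permUnitary H n τ :=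
  TensorPower.unitary_ext fun x => by simp [permUnitary_tprod]

variable [CompleteSpace H]

/-- The unitary operator `u ⊗ ⋯ ⊗ u` on `H^{⊗n}`. -/
def diagUnitary (n : ℕ) (u : unitary (H →L[ℂ] H)) :
    unitary (TensorPower H n →L[ℂ] TensorPower H n) :=
  TensorPower.extend
    (PiTensorProduct.congr fun _ : Fin n => (Unitary.linearIsometryEquiv u).toLinearEquiv)
    fun x y => by
      have h : ∀ x : Fin n → H, (PiTensorProduct.congr
          fun _ : Fin n => (Unitary.linearIsometryEquiv u).toLinearEquiv)
          (AlgTensorPower.tprod x)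
            = AlgTensorPower.tprod fun i => (u : H →L[ℂ] H) (x i) :=
        fun x => PiTensorProduct.congr_tprod _ x
      erw [h, h]
      rw [AlgTensorPower.inner_tprod_tprod, AlgTensorPower.inner_tprod_tprod]
      exact Finset.prod_congr rfl fun i _ => Unitary.inner_map_map u (x i) (y i)

theorem diagUnitary_tprod (u : unitary (H →L[ℂ] H)) (x : Fin n → H) :
    (diagUnitary n u : TensorPower H n →L[ℂ] TensorPower H n) (TensorPower.tprod x)
      = TensorPower.tprod fun i => (u : H →L[ℂ] H) (x i) := by
  refine (TensorPower.extend_coe _ _ _).trans ?_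
  exact congrArg _ (PiTensorProduct.congr_tprod _ x)

/-- The diagonal homomorphism `U(H) → U(H^{⊗n})`, `u ↦ u ⊗ ⋯ ⊗ u`. -/
def unitaryPow (n : ℕ) :
    unitary (H →L[ℂ] H) →* unitary (TensorPower H n →L[ℂ] TensorPower H n) where
  toFun := diagUnitary n
  map_one' := TensorPower.unitary_ext fun x => by simp [diagUnitary_tprod]
  map_mul' u u' := TensorPower.unitary_ext fun x => by simp [diagUnitary_tprod]

theorem unitaryPow_tprod (u : unitary (H →L[ℂ] H)) (x : Fin n → H) :
    (unitaryPow n u : TensorPower H n →L[ℂ] TensorPower H n) (TensorPower.tprod x)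
      = TensorPower.tprod fun i => (u : H →L[ℂ] H) (x i) :=
  diagUnitary_tprod u x

end TensorPower
/-! ### The projective unitary group -/

section PU

variable (H : Type v) [NormedAddCommGroup H] [InnerProductSpace ℂ H] [CompleteSpace H]

/-- The subgroup `S¹` of `U(H)` of scalar unitary operators. -/
def scalarUnitary : Subgroup (unitary (H →L[ℂ] H)) where
  carrier := {u | ∃ z : ℂ, ‖z‖ = 1 ∧ (u : H →L[ℂ] H) = z • 1}
  mul_mem' := by
    rintro u u' ⟨z, hz, hu⟩ ⟨z', hz', hu'⟩
    refine ⟨z * z', by rw [norm_mul, hz, hz', one_mul], ?_⟩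
    simp [hu, hu', smul_smul, mul_comm]
  one_mem' := ⟨1, by simp, by simp⟩
  inv_mem' := by
    rintro u ⟨z, hz, hu⟩
    refine ⟨starRingEnd ℂ z, by simpa using hz, ?_⟩
    rw [← Unitary.star_eq_inv, Unitary.coe_star, hu]
    simp

instance : (scalarUnitary H).Normal where
  conj_mem := by
    rintro u ⟨z, hz, hu⟩ g
    refine ⟨z, hz, ?_⟩
    have h : (g : H →L[ℂ] H) * ((g⁻¹ : unitary (H →L[ℂ] H)) : H →L[ℂ] H) = 1 := by
      rw [← Submonoid.coe_mul, mul_inv_cancel, Submonoid.coe_one]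
    rw [Submonoid.coe_mul, Submonoid.coe_mul, hu]
    simp [h]

/-- The projective unitary group `PU(H) = U(H) / S¹`. -/
def PU : Type v := unitary (H →L[ℂ] H) ⧸ scalarUnitary H

instance : Group (PU H) := inferInstanceAs (Group (unitary (H →L[ℂ] H) ⧸ scalarUnitary H))

variable {H}

/-- The class in `PU(H)` of a unitary operator. -/
def PU.mk : unitary (H →L[ℂ] H) →* PU H := QuotientGroup.mk' (scalarUnitary H)

theorem PU.mk_surjective : Function.Surjective (PU.mk (H := H)) :=
  QuotientGroup.mk'_surjective _

/-- The strong operator topology on `U(H)` (the topology of pointwise convergence on `H`). -/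
abbrev strongTopology (H : Type v) [NormedAddCommGroup H] [InnerProductSpace ℂ H] [CompleteSpace H] :
    TopologicalSpace (unitary (H →L[ℂ] H)) :=
  TopologicalSpace.induced (fun u : unitary (H →L[ℂ] H) => ((u : H →L[ℂ] H) : H → H))
    Pi.topologicalSpace

/-- `PU(H)` carries the quotient of the strong operator topology. As this is coarser than the
quotient of the norm topology, a map into `PU(H)` that is continuous for the norm topology is
continuous for this one. -/
instance : TopologicalSpace (PU H) := (strongTopology H).coinduced PU.mk

theorem unitaryPow_scalar (n : ℕ) {u : unitary (H →L[ℂ] H)} (hu : u ∈ scalarUnitary H) :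
    unitaryPow n u ∈ scalarUnitary (TensorPower H n) := by
  obtain ⟨z, hz, hu⟩ := hu
  refine ⟨z ^ n, by rw [norm_pow, hz, one_pow], TensorPower.clm_ext fun x => ?_⟩
  rw [unitaryPow_tprod, hu]
  have h := (AlgTensorPower.tprod (H := H) (n := n)).map_smul_univ (fun _ => z) x
  rw [Finset.prod_const, Finset.card_univ, Fintype.card_fin] at h
  exact (congrArg (fun t : AlgTensorPower H n => (t : TensorPower H n)) h).trans
    (UniformSpace.Completion.coe_smul _ _)

/-- The diagonal homomorphism `PU(H) → PU(H^{⊗n})` induced by `u ↦ u ⊗ ⋯ ⊗ u`. -/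
def PU.pow (n : ℕ) : PU H →* PU (TensorPower H n) :=
  QuotientGroup.map (scalarUnitary H) (scalarUnitary (TensorPower H n)) (unitaryPow n)
    fun _ hu => unitaryPow_scalar n hu

theorem PU.pow_mk (n : ℕ) (u : unitary (H →L[ℂ] H)) :
    PU.pow n (PU.mk u) = PU.mk (unitaryPow n u) := rfl

theorem PU.continuous_pow (n : ℕ) : Continuous (PU.pow n : PU H → PU (TensorPower H n)) := by
  refine continuous_coinduced_dom.2 ?_
  have h : @Continuous _ _ (strongTopology H) (strongTopology (TensorPower H n))
      (unitaryPow n : unitary (H →L[ℂ] H) → _) := by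
    let _ : TopologicalSpace (unitary (H →L[ℂ] H)) := strongTopology H
    refine continuous_induced_rng.2 (continuous_pi fun t => ?_)
    have he : ∀ y : H, Continuous fun u : unitary (H →L[ℂ] H) => (u : H →L[ℂ] H) y := fun y =>
      (continuous_apply y).comp continuous_induced_dom
    refine TensorPower.induction (p := fun t => Continuous fun u : unitary (H →L[ℂ] H) =>
      (unitaryPow n u : TensorPower H n →L[ℂ] TensorPower H n) t) t ?_ ?_ ?_ ?_ ?_
    · refine isClosed_of_closure_subset fun t ht => ?_
      refine continuous_of_uniform_approx_of_continuous fun U hU => ?_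
      obtain ⟨ε, hε, hεU⟩ := Metric.mem_uniformity_dist.1 hU
      obtain ⟨s, hs, hst⟩ := Metric.mem_closure_iff.1 ht ε hε
      refine ⟨_, hs, fun u => hεU ?_⟩
      rw [dist_eq_norm, ← map_sub, Unitary.norm_map, ← dist_eq_norm]
      exact hst
    · simpa using continuous_const
    · intro s t hs ht
      simp only [map_add]
      exact hs.add ht
    · intro c s hs
      simp only [map_smul]
      exact hs.const_smul c
    · intro x
      simp only [unitaryPow_tprod]
      exact TensorPower.continuous_tprod.comp (continuous_pi fun i => he (x i))
  have h2 : @Continuous _ _ (strongTopology (TensorPower H n)) _ (PU.mk (H := TensorPower H n)) :=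
    continuous_coinduced_rng
  exact @Continuous.comp _ _ _ (strongTopology H) (strongTopology (TensorPower H n)) _ _ _ h2 h

/-- The class in `PU(H^{⊗n})` of the permutation operators. -/
def permPU (H : Type v) [NormedAddCommGroup H] [InnerProductSpace ℂ H] (n : ℕ)
    (σ : Equiv.Perm (Fin n)) : PU (TensorPower H n) :=
  PU.mk (permUnitary H n σ)

theorem permUnitary_commute (n : ℕ) (σ : Equiv.Perm (Fin n)) (u : unitary (H →L[ℂ] H)) :
    permUnitary H n σ * unitaryPow n u = unitaryPow n u * permUnitary H n σ :=
  TensorPower.unitary_ext fun x => by simp [permUnitary_tprod, unitaryPow_tprod]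

theorem permPU_commute (n : ℕ) (σ : Equiv.Perm (Fin n)) (p : PU H) :
    permPU H n σ * PU.pow n p = PU.pow n p * permPU H n σ := by
  obtain ⟨u, rfl⟩ := PU.mk_surjective p
  rw [PU.pow_mk, permPU, ← map_mul, ← map_mul, permUnitary_commute]

end PU

/-! ### Compact operators -/

section Compact

variable (H : Type v) [NormedAddCommGroup H] [InnerProductSpace ℂ H]

/-- The subalgebra of compact operators in the algebra of bounded operators on `H`. -/
def compactOp : NonUnitalSubalgebra ℂ (H →L[ℂ] H) where
  carrier := {k | IsCompactOperator k}
  add_mem' hf hg := hf.add hg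
  zero_mem' := isCompactOperator_zero
  smul_mem' c _ hf := hf.smul c
  mul_mem' {_ g} hf _ := hf.comp_clm g

/-- The algebra `𝒦(H)` of compact operators on `H`, with the operator norm, as a type. -/
def CompactOp : Type v := compactOp H

instance : NonUnitalNormedRing (CompactOp H) := inferInstanceAs (NonUnitalNormedRing (compactOp H))

instance : Module ℂ (CompactOp H) := inferInstanceAs (Module ℂ (compactOp H))

instance : NormedSpace ℂ (CompactOp H) where
  norm_smul_le c k := (norm_smul c k.1).le

instance : IsScalarTower ℂ (CompactOp H) (CompactOp H) :=
  inferInstanceAs (IsScalarTower ℂ (compactOp H) (compactOp H))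

instance : SMulCommClass ℂ (CompactOp H) (CompactOp H) :=
  inferInstanceAs (SMulCommClass ℂ (compactOp H) (compactOp H))

variable {H} [CompleteSpace H]

/-- The action of `PU(H)` on the bounded operators of `H` by conjugation. -/
def PU.conj : PU H →* ((H →L[ℂ] H) ≃⋆ₐ[ℂ] (H →L[ℂ] H)) :=
  QuotientGroup.lift (scalarUnitary H) (Unitary.conjStarAlgAut ℂ (H →L[ℂ] H)) (by
    rintro u ⟨z, hz, hu⟩
    ext1 k
    have hz' : z * starRingEnd ℂ z = 1 := by
      rw [Complex.mul_conj, Complex.normSq_eq_norm_sq, hz]; simp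
    simp [Unitary.conjStarAlgAut_apply, hu, smul_smul, mul_comm, hz'])

theorem PU.conj_mk (u : unitary (H →L[ℂ] H)) (k : H →L[ℂ] H) :
    PU.conj (PU.mk u) k = u * k * (star u : H →L[ℂ] H) := rfl

theorem PU.conj_mem (p : PU H) {k : H →L[ℂ] H} (hk : k ∈ compactOp H) :
    PU.conj p k ∈ compactOp H := by
  obtain ⟨u, rfl⟩ := PU.mk_surjective p
  rw [PU.conj_mk]
  exact IsCompactOperator.comp_clm (IsCompactOperator.clm_comp hk (u : H →L[ℂ] H)) _

/-- The action of `PU(H)` on `𝒦(H)` by conjugation. -/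
def PU.act (p : PU H) : CompactOp H →ₙₐ[ℂ] CompactOp H where
  toFun k := ⟨PU.conj p k.1, PU.conj_mem p k.2⟩
  map_smul' c k := Subtype.ext (map_smul (PU.conj p) c k.1)
  map_zero' := Subtype.ext (map_zero (PU.conj p))
  map_add' k k' := Subtype.ext (map_add (PU.conj p) k.1 k'.1)
  map_mul' k k' := Subtype.ext (map_mul (PU.conj p) k.1 k'.1)

theorem PU.act_one (k : CompactOp H) : PU.act 1 k = k :=
  Subtype.ext (congrArg (fun f : (H →L[ℂ] H) ≃⋆ₐ[ℂ] (H →L[ℂ] H) => f k.1) (map_one PU.conj))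

theorem PU.act_mul (p q : PU H) (k : CompactOp H) : PU.act (p * q) k = PU.act p (PU.act q k) :=
  Subtype.ext (congrArg (fun f : (H →L[ℂ] H) ≃⋆ₐ[ℂ] (H →L[ℂ] H) => f k.1) (map_mul PU.conj p q))

theorem PU.continuous_act (p : PU H) : Continuous (PU.act p) := by
  obtain ⟨u, rfl⟩ := PU.mk_surjective p
  refine Continuous.subtype_mk (f := fun k : compactOp H => PU.conj (PU.mk u) k.1) ?_ _
  simp only [PU.conj_mk]
  fun_prop

end Compact
/-! ### Group actions on algebras, and equivariant `K`-theory -/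

section EquivariantK

/-- An action of a group `G` on a complex, not necessarily unital, algebra by automorphisms. -/
structure AlgAction (G : Type w) [Group G] (A : Type u) [NonUnitalRing A] [Module ℂ A] where
  act : G → A →ₙₐ[ℂ] A
  act_one : ∀ a, act 1 a = a
  act_mul : ∀ g h a, act (g * h) a = act g (act h a)

/-- The trivial action. -/
def AlgAction.trivial (G : Type w) [Group G] (A : Type u) [NonUnitalRing A] [Module ℂ A] :
    AlgAction G A where
  act _ := NonUnitalAlgHom.id ℂ A
  act_one _ := rfl
  act_mul _ _ _ := rfl

/-- An equivariant module over the unital algebra `R`, on which `G` acts through `θ`: a finitely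
generated projective left `R`-module `E` with an action of `G` such that `g (r e) = (g r) (g e)`.
(For a finite group `G` acting on a Banach algebra, the action on `E` is automatically
continuous.) -/
structure EquivModule {G : Type w} [Group G] {R : Type*} [Ring R] [Algebra ℂ R]
    (θ : G →* (R →ₐ[ℂ] R)) : Type _ where
  carrier : Type u
  [addCommGroup : AddCommGroup carrier]
  [module : Module R carrier]
  [finite : Module.Finite R carrier]
  [projective : Module.Projective R carrier]
  act : G → carrier →+ carrier
  act_one : ∀ e, act 1 e = e
  act_mul : ∀ g h e, act (g * h) e = act g (act h e)
  act_smul : ∀ g (r : R) e, act g (r • e) = θ g r • act g e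

attribute [instance] EquivModule.addCommGroup EquivModule.module EquivModule.finite
  EquivModule.projective

variable {G : Type w} [Group G]

section Unital

variable {R : Type*} [Ring R] [Algebra ℂ R] {θ : G →* (R →ₐ[ℂ] R)}

namespace EquivModule

/-- Isomorphism of equivariant modules: an `R`-linear bijection commuting with `G`. -/
def Iso (E F : EquivModule.{u} θ) : Prop :=
  ∃ f : E.carrier ≃ₗ[R] F.carrier, ∀ g e, f (E.act g e) = F.act g (f e)

variable (θ) in
/-- Isomorphism is an equivalence relation. -/
instance setoid : Setoid (EquivModule.{u} θ) where
  r := Iso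
  iseqv :=
    { refl := fun _ => ⟨LinearEquiv.refl _ _, fun _ _ => rfl⟩
      symm := fun {E F} ⟨f, hf⟩ => ⟨f.symm, fun g e => by
        rw [LinearEquiv.symm_apply_eq, hf, LinearEquiv.apply_symm_apply]⟩
      trans := fun ⟨f, hf⟩ ⟨f', hf'⟩ => ⟨f.trans f', fun g e => by simp [hf, hf']⟩ }

/-- The direct sum of two equivariant modules. -/
def sum (E F : EquivModule.{u} θ) : EquivModule.{u} θ where
  carrier := E.carrier × F.carrier
  act g := (E.act g).prodMap (F.act g)
  act_one _ := Prod.ext (E.act_one _) (F.act_one _)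
  act_mul g h _ := Prod.ext (E.act_mul g h _) (F.act_mul g h _)
  act_smul g r _ := Prod.ext (E.act_smul g r _) (F.act_smul g r _)

variable (θ) in
/-- The zero module. -/
def zero : EquivModule.{u} θ where
  carrier := PUnit
  act _ := AddMonoidHom.id _
  act_one _ := rfl
  act_mul _ _ _ := rfl
  act_smul _ _ _ := rfl

variable (θ) in
/-- The set of isomorphism classes of equivariant modules. -/
def IsoClass : Type _ := Quotient (setoid.{u} θ)

/-- Direct sum of isomorphism classes. -/
instance : Add (IsoClass.{u} θ) where
  add := Quotient.map₂ sum fun _ _ ⟨f, hf⟩ _ _ ⟨f', hf'⟩ =>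
    ⟨f.prodCongr f', fun g _ => Prod.ext (hf g _) (hf' g _)⟩

instance : Zero (IsoClass.{u} θ) where
  zero := ⟦zero θ⟧

/-- Isomorphism classes form a commutative monoid under direct sum. -/
instance : AddCommMonoid (IsoClass.{u} θ) where
  add_assoc := by
    rintro ⟨E⟩ ⟨F⟩ ⟨K⟩
    exact Quotient.sound ⟨LinearEquiv.prodAssoc R _ _ _, fun _ _ => rfl⟩
  zero_add := by
    rintro ⟨E⟩
    exact Quotient.sound ⟨(LinearEquiv.uniqueProd : (PUnit.{u + 1} × E.carrier) ≃ₗ[R] E.carrier),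
      fun _ _ => rfl⟩
  add_zero := by
    rintro ⟨E⟩
    exact Quotient.sound ⟨(LinearEquiv.prodUnique : (E.carrier × PUnit.{u + 1}) ≃ₗ[R] E.carrier),
      fun _ _ => rfl⟩
  add_comm := by
    rintro ⟨E⟩ ⟨F⟩
    exact Quotient.sound ⟨LinearEquiv.prodComm R _ _, fun _ _ => rfl⟩
  nsmul := nsmulRec

end EquivModule

variable (θ) in
/-- The equivariant `K`-group of a unital algebra: the Grothendieck group of the category of
equivariant finitely generated projective modules. -/
abbrev UnitalK : Type _ := Algebra.GrothendieckAddGroup (EquivModule.IsoClass.{u} θ)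

end Unital

section NonUnital

variable {A : Type u} [NonUnitalRing A] [Module ℂ A] [IsScalarTower ℂ A A] [SMulCommClass ℂ A A]

/-- The automorphism `z + a ↦ z + g a` of the algebra `A⁺` with a unit added. -/
def AlgAction.unitizationHom (α : AlgAction G A) (g : G) :
    Unitization ℂ A →ₐ[ℂ] Unitization ℂ A :=
  Unitization.lift ((Unitization.inrNonUnitalAlgHom ℂ A).comp (α.act g))

theorem AlgAction.unitizationHom_apply (α : AlgAction G A) (g : G) (z : ℂ) (a : A) :
    α.unitizationHom g (Unitization.inl z + (a : Unitization ℂ A))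
      = Unitization.inl z + ((α.act g a : A) : Unitization ℂ A) := by
  simp [AlgAction.unitizationHom, Unitization.algebraMap_eq_inl]

/-- The action on the algebra `A⁺` with a unit added. -/
def AlgAction.unitization (α : AlgAction G A) :
    G →* (Unitization ℂ A →ₐ[ℂ] Unitization ℂ A) where
  toFun := α.unitizationHom
  map_one' := by
    refine AlgHom.ext fun x => ?_
    induction x using Unitization.ind with
    | inl_add_inr z a => rw [α.unitizationHom_apply, α.act_one]; rfl
  map_mul' g h := by
    refine AlgHom.ext fun x => ?_
    induction x using Unitization.ind with
    | inl_add_inr z a =>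
      rw [AlgHom.mul_apply, α.unitizationHom_apply, α.unitizationHom_apply,
        α.unitizationHom_apply, α.act_mul]

/-- The submodule `A E` of a module `E` over `A⁺`. -/
def augSubmodule (A : Type u) [NonUnitalRing A] [Module ℂ A] [IsScalarTower ℂ A A]
    [SMulCommClass ℂ A A] (E : Type u) [AddCommGroup E] [Module (Unitization ℂ A) E] :
    Submodule (Unitization ℂ A) E :=
  Submodule.span _ {e | ∃ (a : A) (e' : E), (a : Unitization ℂ A) • e' = e}

theorem smul_augQuotient {E : Type u} [AddCommGroup E] [Module (Unitization ℂ A) E]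
    (r : Unitization ℂ A) (q : E ⧸ augSubmodule A E) :
    r • q = (Unitization.inl r.fst : Unitization ℂ A) • q := by
  obtain ⟨e, rfl⟩ := Submodule.Quotient.mk_surjective _ q
  rw [← Submodule.Quotient.mk_smul, ← Submodule.Quotient.mk_smul, Submodule.Quotient.eq,
    ← sub_smul]
  refine Submodule.subset_span ⟨r.snd, e, ?_⟩
  congr 1
  rw [eq_sub_iff_add_eq, add_comm, Unitization.inl_fst_add_inr_snd_eq]

/-- The action of `g` on `E`, as a semilinear map. -/
def EquivModule.actₛₗ {R : Type*} [Ring R] [Algebra ℂ R] {θ : G →* (R →ₐ[ℂ] R)}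
    (E : EquivModule.{u} θ) (g : G) : E.carrier →ₛₗ[(θ g : R →+* R)] E.carrier where
  toFun := E.act g
  map_add' := map_add _
  map_smul' := E.act_smul g

theorem augSubmodule_le_comap (α : AlgAction G A) (E : EquivModule.{u} α.unitization) (g : G) :
    augSubmodule A E.carrier ≤ (augSubmodule A E.carrier).comap (E.actₛₗ g) := by
  refine Submodule.span_le.2 ?_
  rintro _ ⟨a, e, rfl⟩
  refine Submodule.subset_span ⟨α.act g a, E.act g e, ?_⟩
  have h : α.unitization g (a : Unitization ℂ A) = ((α.act g a : A) : Unitization ℂ A) := by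
    have := α.unitizationHom_apply g 0 a
    rwa [Unitization.inl_zero, zero_add, zero_add] at this
  rw [← h]
  exact (E.act_smul g _ e).symm

/-- Extension of scalars `E ↦ ℂ ⊗_{A⁺} E = E / A E` along the augmentation `A⁺ → ℂ`. -/
def augModule (α : AlgAction G A) (E : EquivModule.{u} α.unitization) :
    EquivModule.{u} (1 : G →* (ℂ →ₐ[ℂ] ℂ)) :=
  letI : Module ℂ (E.carrier ⧸ augSubmodule A E.carrier) :=
    Module.compHom _ (algebraMap ℂ (Unitization ℂ A))
  have hsmul : ∀ (z : ℂ) (q : E.carrier ⧸ augSubmodule A E.carrier),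
    z • q = (Unitization.inl z : Unitization ℂ A) • q := fun _ _ => rfl
  have hfin : Module.Finite ℂ (E.carrier ⧸ augSubmodule A E.carrier) := by
    obtain ⟨s, hs⟩ := (inferInstance :
      Module.Finite (Unitization ℂ A) (E.carrier ⧸ augSubmodule A E.carrier)).fg_top
    refine ⟨⟨s, eq_top_iff.2 fun q _ => ?_⟩⟩
    have hq : q ∈ Submodule.span (Unitization ℂ A)
      (s : Set (E.carrier ⧸ augSubmodule A E.carrier)) := hs ▸ Submodule.mem_top
    induction hq using Submodule.span_induction with
    | mem x hx => exact Submodule.subset_span hx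
    | zero => exact Submodule.zero_mem _
    | add x y _ _ hx hy => exact Submodule.add_mem _ (hx trivial) (hy trivial)
    | smul r x _ hx =>
      rw [smul_augQuotient, ← hsmul]
      exact Submodule.smul_mem _ _ (hx trivial)
  { carrier := E.carrier ⧸ augSubmodule A E.carrier
    finite := hfin
    projective := Module.Projective.of_free
    act := fun g =>
      (Submodule.mapQ _ _ (E.actₛₗ g) (augSubmodule_le_comap α E g)).toAddMonoidHom
    act_one := by
      intro q
      obtain ⟨e, rfl⟩ := Submodule.Quotient.mk_surjective _ q
      exact congrArg Submodule.Quotient.mk (E.act_one e)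
    act_mul := by
      intro g h q
      obtain ⟨e, rfl⟩ := Submodule.Quotient.mk_surjective _ q
      exact congrArg Submodule.Quotient.mk (E.act_mul g h e)
    act_smul := by
      intro g z q
      obtain ⟨e, rfl⟩ := Submodule.Quotient.mk_surjective _ q
      have h : α.unitization g (Unitization.inl z) = Unitization.inl z :=
        (α.unitization g).commutes z
      refine (congrArg Submodule.Quotient.mk (E.act_smul g (Unitization.inl z) e)).trans ?_
      rw [h]
      rfl }

theorem augSubmodule_le_comap_linear {E F : Type u} [AddCommGroup E] [Module (Unitization ℂ A) E]
    [AddCommGroup F] [Module (Unitization ℂ A) F] (f : E →ₗ[Unitization ℂ A] F) :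
    augSubmodule A E ≤ (augSubmodule A F).comap f := by
  refine Submodule.span_le.2 ?_
  rintro _ ⟨a, e, rfl⟩
  exact Submodule.subset_span ⟨a, f e, (map_smul f _ e).symm⟩

/-- The map `E / A E → F / A F` induced by a linear map. -/
def augMap {E F : Type u} [AddCommGroup E] [Module (Unitization ℂ A) E]
    [AddCommGroup F] [Module (Unitization ℂ A) F] (f : E →ₗ[Unitization ℂ A] F) :
    (E ⧸ augSubmodule A E) →ₗ[Unitization ℂ A] (F ⧸ augSubmodule A F) :=
  Submodule.mapQ _ _ f (augSubmodule_le_comap_linear f)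

theorem augModule_congr (α : AlgAction G A) {E F : EquivModule.{u} α.unitization}
    (h : E.Iso F) : (augModule α E).Iso (augModule α F) := by
  obtain ⟨f, hf⟩ := h
  refine ⟨{ toFun := augMap (A := A) f.toLinearMap
            invFun := augMap (A := A) f.symm.toLinearMap
            map_add' := map_add (augMap (A := A) f.toLinearMap)
            map_smul' := fun z (q : E.carrier ⧸ augSubmodule A E.carrier) =>
              map_smul (augMap (A := A) f.toLinearMap) (Unitization.inl z : Unitization ℂ A) q
            left_inv := ?_
            right_inv := ?_ }, ?_⟩
  · intro q
    obtain ⟨e, rfl⟩ := Submodule.Quotient.mk_surjective _ q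
    exact congrArg Submodule.Quotient.mk (f.symm_apply_apply e)
  · intro q
    obtain ⟨e, rfl⟩ := Submodule.Quotient.mk_surjective _ q
    exact congrArg Submodule.Quotient.mk (f.apply_symm_apply e)
  · intro g q
    obtain ⟨e, rfl⟩ := Submodule.Quotient.mk_surjective _ q
    exact congrArg Submodule.Quotient.mk (hf g e)

theorem augModule_zero (α : AlgAction G A) :
    (augModule α (EquivModule.zero.{u} α.unitization)).Iso (EquivModule.zero.{u} 1) := by
  refine ⟨{ toFun := fun _ => PUnit.unit
            invFun := fun _ => 0
            map_add' := fun _ _ => rfl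
            map_smul' := fun _ _ => rfl
            left_inv := ?_
            right_inv := fun _ => rfl }, fun _ _ => rfl⟩
  intro q
  obtain ⟨e, rfl⟩ := Submodule.Quotient.mk_surjective _ q
  rfl

theorem augModule_sum (α : AlgAction G A) (E F : EquivModule.{u} α.unitization) :
    (augModule α (E.sum F)).Iso ((augModule α E).sum (augModule α F)) := by
  refine ⟨{ toFun := fun q =>
              (augMap (A := A) (LinearMap.fst (Unitization ℂ A) E.carrier F.carrier) q,
                augMap (A := A) (LinearMap.snd (Unitization ℂ A) E.carrier F.carrier) q)
            invFun := fun q =>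
              augMap (A := A) (LinearMap.inl (Unitization ℂ A) E.carrier F.carrier) q.1
                + augMap (A := A) (LinearMap.inr (Unitization ℂ A) E.carrier F.carrier) q.2
            map_add' := fun q q' => Prod.ext
              (map_add (augMap (A := A) (LinearMap.fst (Unitization ℂ A) E.carrier F.carrier)) q q')
              (map_add (augMap (A := A) (LinearMap.snd (Unitization ℂ A) E.carrier F.carrier)) q q')
            map_smul' := fun z (q : (E.carrier × F.carrier) ⧸
                augSubmodule A (E.carrier × F.carrier)) => Prod.ext
              (map_smul (augMap (A := A) (LinearMap.fst (Unitization ℂ A) E.carrier F.carrier))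
                (Unitization.inl z : Unitization ℂ A) q)
              (map_smul (augMap (A := A) (LinearMap.snd (Unitization ℂ A) E.carrier F.carrier))
                (Unitization.inl z : Unitization ℂ A) q)
            left_inv := ?_
            right_inv := ?_ }, ?_⟩
  · intro q
    obtain ⟨⟨e, e'⟩, rfl⟩ := Submodule.Quotient.mk_surjective _ q
    exact congrArg Submodule.Quotient.mk
      (Prod.ext (add_zero e) (zero_add e') : ((e, 0) + (0, e') : E.carrier × F.carrier) = (e, e'))
  · rintro ⟨q, q'⟩
    obtain ⟨e, rfl⟩ := Submodule.Quotient.mk_surjective _ q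
    obtain ⟨e', rfl⟩ := Submodule.Quotient.mk_surjective _ q'
    exact Prod.ext (congrArg Submodule.Quotient.mk (add_zero e))
      (congrArg Submodule.Quotient.mk (zero_add e'))
  · intro g q
    obtain ⟨⟨e, e'⟩, rfl⟩ := Submodule.Quotient.mk_surjective _ q
    rfl

/-- The homomorphism `K_G(A⁺) → K_G(ℂ)` induced by the augmentation, with `G` acting trivially
on `ℂ`. -/
def augmentation (α : AlgAction G A) :
    UnitalK.{u} α.unitization →+ UnitalK.{u} (1 : G →* (ℂ →ₐ[ℂ] ℂ)) :=
  Algebra.GrothendieckAddGroup.lift (Algebra.GrothendieckAddGroup.of.comp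
    { toFun := Quotient.map (augModule α) fun _ _ => augModule_congr α
      map_zero' := Quotient.sound (augModule_zero α)
      map_add' := by
        rintro ⟨E⟩ ⟨F⟩
        exact Quotient.sound (augModule_sum α E F) })

/-- The equivariant `K`-group `K_G(A)` of a not necessarily unital algebra: the kernel of
`K_G(A⁺) → K_G(ℂ)`. -/
def EquivariantK (α : AlgAction G A) : AddSubgroup (UnitalK.{u} α.unitization) :=
  (augmentation α).ker

end NonUnital

end EquivariantK

/-! ### Bundles of algebras modelled on compact operators -/

section Bundle

/-- A bundle of algebras on `X` with fibre `𝒦(H)` and structural group `PU(H)`, given by its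
transition functions: a covering of `X` by open sets `U i` and a cocycle of continuous functions
`g j i : U i ∩ U j → PU(H)`. The bundle is obtained by gluing the products `U i × 𝒦(H)` with the
help of the `g j i`. (Values of `g j i` outside `U i ∩ U j` are irrelevant.) -/
structure AlgBundle (X : Type u) [TopologicalSpace X] (H : Type v) [NormedAddCommGroup H]
    [InnerProductSpace ℂ H] [CompleteSpace H] : Type (max u v (w + 1)) where
  ι : Type w
  U : ι → Set X
  isOpen_U : ∀ i, IsOpen (U i)
  cover : ∀ x, ∃ i, x ∈ U i
  g : ι → ι → X → PU H
  continuousOn_g : ∀ i j, ContinuousOn (g j i) (U i ∩ U j)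
  cocycle : ∀ i j k x, x ∈ U i → x ∈ U j → x ∈ U k → g k j x * g j i x = g k i x

namespace AlgBundle

variable {X : Type u} [TopologicalSpace X] {H : Type v} [NormedAddCommGroup H]
  [InnerProductSpace ℂ H] [CompleteSpace H]

/-- The tensor power `𝒜^{⊗n}`: the bundle with fibre `𝒦(H^{⊗n})` whose transition functions are the
images of those of `𝒜` under the diagonal homomorphism `PU(H) → PU(H^{⊗n})`. -/
def pow (𝒜 : AlgBundle.{u, v, w} X H) (n : ℕ) : AlgBundle.{u, v, w} X (TensorPower H n) where
  ι := 𝒜.ι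
  U := 𝒜.U
  isOpen_U := 𝒜.isOpen_U
  cover := 𝒜.cover
  g j i x := PU.pow n (𝒜.g j i x)
  continuousOn_g i j := (PU.continuous_pow n).comp_continuousOn (𝒜.continuousOn_g i j)
  cocycle i j k x hi hj hk := by rw [← map_mul, 𝒜.cocycle i j k x hi hj hk]

/-- The algebra `Γ(X, 𝒜)` of continuous sections: the families of continuous functions
`s i : U i → 𝒦(H)` such that `s j = g j i · s i` on `U i ∩ U j`. -/
def sectionSubalgebra (𝒜 : AlgBundle.{u, v, w} X H) :
    NonUnitalSubalgebra ℂ (∀ i, C(𝒜.U i, CompactOp H)) where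
  carrier := {s | ∀ i j x (hi : x ∈ 𝒜.U i) (hj : x ∈ 𝒜.U j),
    s j ⟨x, hj⟩ = PU.act (𝒜.g j i x) (s i ⟨x, hi⟩)}
  add_mem' hs ht i j x hi hj := by
    simp only [Pi.add_apply, ContinuousMap.add_apply, map_add, hs i j x hi hj, ht i j x hi hj]
  zero_mem' i j x hi hj := by
    simp only [Pi.zero_apply, ContinuousMap.zero_apply, map_zero]
  smul_mem' c s hs i j x hi hj := by
    simp only [Pi.smul_apply, ContinuousMap.smul_apply, map_smul, hs i j x hi hj]
  mul_mem' hs ht i j x hi hj := by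
    simp only [Pi.mul_apply, ContinuousMap.mul_apply, map_mul, hs i j x hi hj, ht i j x hi hj]

/-- The algebra of sections `Γ(X, 𝒜)`, as a type. -/
def Sections (𝒜 : AlgBundle.{u, v, w} X H) : Type (max u v w) := 𝒜.sectionSubalgebra

instance (𝒜 : AlgBundle.{u, v, w} X H) : NonUnitalRing 𝒜.Sections :=
  inferInstanceAs (NonUnitalRing 𝒜.sectionSubalgebra)

instance (𝒜 : AlgBundle.{u, v, w} X H) : Module ℂ 𝒜.Sections :=
  inferInstanceAs (Module ℂ 𝒜.sectionSubalgebra)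

instance (𝒜 : AlgBundle.{u, v, w} X H) : IsScalarTower ℂ 𝒜.Sections 𝒜.Sections :=
  inferInstanceAs (IsScalarTower ℂ 𝒜.sectionSubalgebra 𝒜.sectionSubalgebra)

instance (𝒜 : AlgBundle.{u, v, w} X H) : SMulCommClass ℂ 𝒜.Sections 𝒜.Sections :=
  inferInstanceAs (SMulCommClass ℂ 𝒜.sectionSubalgebra 𝒜.sectionSubalgebra)

/-- A family `(s i)` acted upon in each fibre by a fixed element of `PU(H)`. -/
def actFamily (𝒜 : AlgBundle.{u, v, w} X H) (p : PU H)
    (s : ∀ i, C(𝒜.U i, CompactOp H)) : ∀ i, C(𝒜.U i, CompactOp H) := fun i =>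
  ⟨fun x => PU.act p (s i x), (PU.continuous_act p).comp (s i).continuous⟩

/-- The action of the symmetric group on `Γ(X, 𝒜^{⊗n})` by permutation of the factors: in every
fibre `σ` acts through the class in `PU(H^{⊗n})` of the operator which permutes the factors of
`H^{⊗n}`. -/
def permAction (𝒜 : AlgBundle.{u, v, w} X H) (n : ℕ) :
    AlgAction (Equiv.Perm (Fin n)) (𝒜.pow n).Sections where
  act σ :=
    { toFun := fun s => ⟨(𝒜.pow n).actFamily (permPU H n σ) s.1, fun i j x hi hj => by
        refine (congrArg (PU.act (permPU H n σ)) (s.2 i j x hi hj)).trans ?_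
        rw [← PU.act_mul]
        refine (congrArg (fun p => PU.act p (s.1 i ⟨x, hi⟩))
          (permPU_commute n σ (𝒜.g j i x))).trans ?_
        exact PU.act_mul _ _ _⟩
      map_smul' := fun c s => Subtype.ext <| funext fun i => ContinuousMap.ext fun x =>
        map_smul (PU.act (permPU H n σ)) c (s.1 i x)
      map_zero' := Subtype.ext <| funext fun i => ContinuousMap.ext fun x =>
        map_zero (PU.act (permPU H n σ))
      map_add' := fun s t => Subtype.ext <| funext fun i => ContinuousMap.ext fun x =>
        map_add (PU.act (permPU H n σ)) (s.1 i x) (t.1 i x)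
      map_mul' := fun s t => Subtype.ext <| funext fun i => ContinuousMap.ext fun x =>
        map_mul (PU.act (permPU H n σ)) (s.1 i x) (t.1 i x) }
  act_one s := Subtype.ext <| funext fun i => ContinuousMap.ext fun x => by
    refine Eq.trans ?_ (PU.act_one (s.1 i x))
    exact congrArg (fun p => PU.act p (s.1 i x))
      (by rw [permPU, permUnitary_one, map_one] : permPU H n 1 = 1)
  act_mul σ τ s := Subtype.ext <| funext fun i => ContinuousMap.ext fun x => by
    refine Eq.trans ?_ (PU.act_mul (permPU H n σ) (permPU H n τ) (s.1 i x))
    exact congrArg (fun p => PU.act p (s.1 i x))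
      (by rw [permPU, permUnitary_mul, map_mul]; rfl)

end AlgBundle

end Bundle

end
end TwistedK

/-!
# Equivariant twisted `K`-theory and inner actions

The equivariant `K`-group of an algebra with an action that is implemented by multipliers does not
depend on the action. The equivariant `K`-group is identified with the kernel of an augmentation on
`K₀` of a ring of invariant matrices (a crossed product), and that kernel is determined by the
augmentation ideal, by excision.
-/

namespace TwistedK

noncomputable section

/-! ### `K₀` of a ring, by idempotent matrices -/

section KZero

open Matrix

/-! The permutation operators `ρ(σ)` form a genuine unitary representation, and they commute with
every `u ⊗ ⋯ ⊗ u`, hence with the transition functions. Left and right multiplication by `ρ(σ)` are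
therefore defined on `A = Γ(X, 𝒜^{⊗n})`: the action is conjugation by a group of multipliers of `A`.

If `ρ` took values in a unital algebra, replacing the action of `g` on a module by `e ↦ ρ(g)⁻¹ (g
e)` would finish the proof. Here `ρ` does not lie in `A⁺`, so the argument passes through crossed
products. Equivariant finitely generated projective modules over `A⁺` are the equivariant retracts
of powers of the regular module, because linear splittings can be averaged over the finite group.
Equivariant endomorphisms of the regular module are the `G × G` matrices `a` over `A⁺` with `a(gh,
gk) = g a(h, k)`, a model of `A⁺ ⋊ G`. Hence `K_G(A)` is the kernel of `K₀(A⁺ ⋊ G) → K₀(ℂ[G])`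
(`nonempty_equivariantK_equiv`).

The kernel of `A⁺ ⋊ G → ℂ[G]` is the ideal `A ⋊ G`. Conjugation by the diagonal matrix `D =
diag(ρ(h))` identifies it with the translation invariant matrices over `A`, that is with `A[G]`,
where the action is no longer visible (`MultiplierImplementation.twist`). This identification does
not extend to the rings with their `ℂ[G]`-part, since conjugating an off-diagonal scalar by `D`
leaves `A⁺`; only the multiples of the identity survive. What remains is excision for `K₀`: the
kernel attached to the split extension `A⁺ ⋊ G → ℂ[G]` equals the one attached to `A[G]⁺ → ℂ`, as
the two ideals agree (`ExcisionData.nonempty_ker_equiv`). This is purely algebraic. Its injective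
half rests on Whitehead's lemma, in a form relative to an idempotent (`liftsToCommutant_rotation`).
The group obtained depends on `A` and `G` alone, so the given action and the trivial one yield the
same answer. -/

/-- Equivalence of idempotent matrices. -/
def MvEquiv {C : Type*} [Ring C] {ι κ : Type*} [Fintype ι] [Fintype κ] (e : Matrix ι ι C)
    (f : Matrix κ κ C) : Prop :=
  ∃ (x : Matrix ι κ C) (y : Matrix κ ι C), x * y = e ∧ y * x = f

/-- An idempotent matrix with entries in a ring. -/
structure IdemMat (C : Type u) [Ring C] : Type (max u 1) where
  ι : Type
  [fintype : Fintype ι]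
  [decEq : DecidableEq ι]
  e : Matrix ι ι C
  idem : e * e = e

attribute [instance] IdemMat.fintype IdemMat.decEq

/-! ### Calculus of equivalent idempotents -/

section MvEquiv

variable {C : Type*} [Ring C] {ι κ μ ν : Type*} [Fintype ι] [Fintype κ] [Fintype μ] [Fintype ν]

theorem MvEquiv.symm {e : Matrix ι ι C} {f : Matrix κ κ C} (h : MvEquiv e f) : MvEquiv f e :=
  let ⟨x, y, h1, h2⟩ := h
  ⟨y, x, h2, h1⟩

theorem MvEquiv.refl {e : Matrix ι ι C} (he : e * e = e) : MvEquiv e e := ⟨e, e, he, he⟩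

/-- The two matrices of an equivalence may be cut down to the idempotents. -/
theorem MvEquiv.exists_normal {e : Matrix ι ι C} {f : Matrix κ κ C} (he : e * e = e)
    (hf : f * f = f) (h : MvEquiv e f) : ∃ (x : Matrix ι κ C) (y : Matrix κ ι C),
      x * y = e ∧ y * x = f ∧ e * x = x ∧ x * f = x ∧ f * y = y ∧ y * e = y := by
  obtain ⟨x, y, rfl, rfl⟩ := h
  refine ⟨x * (y * x), y * (x * y), ?_, ?_, ?_, ?_, ?_, ?_⟩ <;> grind [Matrix.mul_assoc]

/-- After normalisation the middle idempotent acts as an identity on the pieces that meet, so the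
products compose. -/
theorem MvEquiv.trans {e : Matrix ι ι C} {f : Matrix κ κ C} {g : Matrix μ μ C}
    (he : e * e = e) (hf : f * f = f) (hg : g * g = g)
    (h : MvEquiv e f) (h' : MvEquiv f g) : MvEquiv e g := by
  obtain ⟨x, y, h1, h2, h3, h4, h5, h6⟩ := h.exists_normal he hf
  obtain ⟨z, t, k1, k2, k3, k4, k5, k6⟩ := h'.exists_normal hf hg
  refine ⟨x * z, t * y, ?_, ?_⟩
  · rw [Matrix.mul_assoc, ← Matrix.mul_assoc z, k1, h5, h1]
  · rw [Matrix.mul_assoc, ← Matrix.mul_assoc y, h2, k3, k2]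

theorem MvEquiv.fromBlocks {e : Matrix ι ι C} {f : Matrix κ κ C} {e' : Matrix μ μ C}
    {f' : Matrix ν ν C} (h : MvEquiv e f) (h' : MvEquiv e' f') :
    MvEquiv (fromBlocks e 0 0 e') (fromBlocks f 0 0 f') := by
  obtain ⟨x, y, rfl, rfl⟩ := h
  obtain ⟨x', y', rfl, rfl⟩ := h'
  exact ⟨.fromBlocks x 0 0 x', .fromBlocks y 0 0 y', by simp [fromBlocks_multiply],
    by simp [fromBlocks_multiply]⟩

theorem MvEquiv.reindex [DecidableEq ι] {e : Matrix ι ι C} (he : e * e = e) (σ : ι ≃ κ) :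
    MvEquiv e (Matrix.reindex σ σ e) := by
  refine ⟨e.submatrix id σ.symm, e.submatrix σ.symm id, ?_, ?_⟩
  · rw [submatrix_mul_equiv, he]; rfl
  · have := submatrix_mul e e σ.symm id σ.symm Function.bijective_id
    rw [← this, he]; rfl

theorem MvEquiv.map {D : Type*} [Ring D] (φ : C →+* D) {e : Matrix ι ι C} {f : Matrix κ κ C}
    (h : MvEquiv e f) : MvEquiv (e.map φ) (f.map φ) := by
  obtain ⟨x, y, rfl, rfl⟩ := h
  exact ⟨x.map φ, y.map φ, by rw [Matrix.map_mul], by rw [Matrix.map_mul]⟩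

theorem MvEquiv.fromBlocks_comm {e : Matrix ι ι C} {f : Matrix κ κ C} (he : e * e = e)
    (hf : f * f = f) : MvEquiv (.fromBlocks e 0 0 f) (.fromBlocks f 0 0 e) :=
  ⟨.fromBlocks 0 e f 0, .fromBlocks 0 f e 0, by simp [fromBlocks_multiply, he, hf],
    by simp [fromBlocks_multiply, he, hf]⟩

theorem MvEquiv.zero_fromBlocks {e : Matrix ι ι C} (he : e * e = e) :
    MvEquiv (.fromBlocks (0 : Matrix κ κ C) 0 0 e) e :=
  ⟨.fromRows 0 e, .fromCols 0 e, by
    rw [fromRows_mul_fromCols]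
    simp [he], by simp [fromCols_mul_fromRows, he]⟩

/-- The column with entries `e` and `1 - e` times the corresponding row is block diagonal, because
the cross terms vanish; the product in the other order is `e + (1 - e)`. This provides complements
to free modules. -/
theorem MvEquiv.fromBlocks_compl [DecidableEq ι] {e : Matrix ι ι C} (he : e * e = e) :
    MvEquiv (.fromBlocks e 0 0 (1 - e)) (1 : Matrix ι ι C) :=
  ⟨.fromRows e (1 - e), .fromCols e (1 - e), by
    rw [fromRows_mul_fromCols]
    simp [mul_sub, sub_mul, he], by simp [fromCols_mul_fromRows, mul_sub, sub_mul, he]⟩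

end MvEquiv

/-! ### The monoid of idempotent classes and its group -/

namespace IdemMat

variable {C : Type u} [Ring C]

instance setoid (C : Type u) [Ring C] : Setoid (IdemMat C) where
  r e f := MvEquiv e.e f.e
  iseqv := ⟨fun e => .refl e.idem, .symm, fun {e f g} h h' => h.trans e.idem f.idem g.idem h'⟩

/-- The block sum of idempotent matrices. -/
def sum (e f : IdemMat C) : IdemMat C where
  ι := e.ι ⊕ f.ι
  e := fromBlocks e.e 0 0 f.e
  idem := by simp [fromBlocks_multiply, e.idem, f.idem]

/-- Change of rings. -/
def map {D : Type v} [Ring D] (φ : C →+* D) (e : IdemMat C) : IdemMat D where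
  ι := e.ι
  e := e.e.map φ
  idem := by rw [← Matrix.map_mul, e.idem]

end IdemMat

/-- Equivalence classes of idempotent matrices. -/
def IdemClass (C : Type u) [Ring C] : Type (max u 1) := Quotient (IdemMat.setoid C)

namespace IdemClass

variable {C : Type u} [Ring C]

/-- The class of an idempotent matrix. -/
def mk (e : IdemMat C) : IdemClass C := Quotient.mk _ e

theorem mk_eq_iff {e f : IdemMat C} : mk e = mk f ↔ MvEquiv e.e f.e :=
  Quotient.eq (r := IdemMat.setoid C)

theorem exists_mk (a : IdemClass C) : ∃ e, mk e = a := Quotient.exists_rep a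

instance : Add (IdemClass C) where
  add := Quotient.map₂ IdemMat.sum fun _ _ h _ _ h' => h.fromBlocks h'

instance : Zero (IdemClass C) where
  zero := mk ⟨Empty, 0, zero_mul _⟩

theorem add_comm' (a b : IdemClass C) : a + b = b + a := by
  obtain ⟨e, rfl⟩ := exists_mk a
  obtain ⟨f, rfl⟩ := exists_mk b
  exact mk_eq_iff.2 (.fromBlocks_comm e.idem f.idem)

theorem zero_add' (a : IdemClass C) : 0 + a = a := by
  obtain ⟨e, rfl⟩ := exists_mk a
  exact mk_eq_iff.2 (.zero_fromBlocks e.idem)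

instance : AddCommMonoid (IdemClass C) where
  add_assoc a b c := by
    obtain ⟨e, rfl⟩ := exists_mk a
    obtain ⟨f, rfl⟩ := exists_mk b
    obtain ⟨g, rfl⟩ := exists_mk c
    refine mk_eq_iff.2 ?_
    have h := MvEquiv.reindex ((e.sum f).sum g).idem (Equiv.sumAssoc e.ι f.ι g.ι)
    have h' : Matrix.reindex (Equiv.sumAssoc e.ι f.ι g.ι) (Equiv.sumAssoc e.ι f.ι g.ι)
        ((e.sum f).sum g).e = (e.sum (f.sum g)).e := by
      ext i j
      rcases i with i | i | i <;> rcases j with j | j | j <;> rfl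
    exact (congrArg (MvEquiv ((e.sum f).sum g).e) h').mp h
  zero_add := zero_add'
  add_zero a := (add_comm' a 0).trans (zero_add' a)
  add_comm := add_comm'
  nsmul := nsmulRec

/-- Change of rings. -/
def map {D : Type v} [Ring D] (φ : C →+* D) : IdemClass C →+ IdemClass D where
  toFun := Quotient.map (IdemMat.map φ) fun _ _ => MvEquiv.map φ
  map_zero' := congrArg mk (by
    simp only [IdemMat.map]
    congr
    ext i; exact i.elim)
  map_add' a b := by
    obtain ⟨e, rfl⟩ := exists_mk a
    obtain ⟨f, rfl⟩ := exists_mk b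
    refine congrArg mk ?_
    have h : ((e.sum f).map φ).e = ((e.map φ).sum (f.map φ)).e := by
      simp only [IdemMat.map, IdemMat.sum]
      rw [fromBlocks_map]
      simp [Matrix.map_zero]
    exact congrArg (fun m : {m : Matrix (e.ι ⊕ f.ι) (e.ι ⊕ f.ι) D // m * m = m} =>
      (⟨_, m.1, m.2⟩ : IdemMat D))
      (Subtype.ext h : (⟨_, ((e.sum f).map φ).idem⟩ : {m : Matrix _ _ D // m * m = m})
        = ⟨_, ((e.map φ).sum (f.map φ)).idem⟩)

end IdemClass

/-- The group `K₀` of a ring. -/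
abbrev KZero (C : Type u) [Ring C] : Type (max u 1) := Algebra.GrothendieckAddGroup (IdemClass C)

namespace KZero

theorem fromBlocks_idem {C : Type*} [Ring C] {ι κ : Type*} [Fintype ι] [Fintype κ]
    {e : Matrix ι ι C} {f : Matrix κ κ C} (he : e * e = e) (hf : f * f = f) :
    fromBlocks e 0 0 f * fromBlocks e 0 0 f = fromBlocks e 0 0 f := by
  simp [fromBlocks_multiply, he, hf]

theorem map_idem {C D ι : Type*} [Ring C] [Ring D] [Fintype ι] (φ : C →+* D) {e : Matrix ι ι C}
    (he : e * e = e) : e.map φ * e.map φ = e.map φ := by rw [← Matrix.map_mul, he]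

variable {C : Type u} [Ring C] {D : Type v} [Ring D] {ι κ : Type} [Fintype ι] [DecidableEq ι]
  [Fintype κ] [DecidableEq κ]

/-- The class in `K₀` of an idempotent matrix. -/
def cl (e : Matrix ι ι C) (he : e * e = e) : KZero C :=
  Algebra.GrothendieckAddGroup.of (IdemClass.mk ⟨ι, e, he⟩)

theorem cl_fromBlocks (e : Matrix ι ι C) (f : Matrix κ κ C) (he : e * e = e) (hf : f * f = f)
    (h : fromBlocks e 0 0 f * fromBlocks e 0 0 f = fromBlocks e 0 0 f) :
    cl (fromBlocks e 0 0 f) h = cl e he + cl f hf :=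
  map_add (Algebra.GrothendieckAddGroup.of (M := IdemClass C)) (IdemClass.mk ⟨ι, e, he⟩)
    (IdemClass.mk ⟨κ, f, hf⟩)

theorem cl_eq_of_equiv {e : Matrix ι ι C} {f : Matrix κ κ C} (he : e * e = e) (hf : f * f = f)
    (h : MvEquiv e f) : cl e he = cl f hf :=
  congrArg Algebra.GrothendieckAddGroup.of (IdemClass.mk_eq_iff.2 h)

theorem cl_zero : cl (0 : Matrix ι ι C) (zero_mul _) = 0 := by
  have h := cl_fromBlocks (0 : Matrix ι ι C) (0 : Matrix ι ι C) (zero_mul _) (zero_mul _)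
    (by simp)
  rw [cl_eq_of_equiv _ (zero_mul _) (.zero_fromBlocks (zero_mul _))] at h
  exact left_eq_add.1 h

theorem one_sub_idem {e : Matrix ι ι C} (he : e * e = e) : (1 - e) * (1 - e) = 1 - e := by
  simp [mul_sub, sub_mul, he]

theorem cl_add_compl (e : Matrix ι ι C) (he : e * e = e) :
    cl e he + cl (1 - e) (one_sub_idem he) = cl (1 : Matrix ι ι C) (one_mul _) := by
  rw [← cl_fromBlocks e (1 - e) he _ (fromBlocks_idem he (one_sub_idem he))]
  exact cl_eq_of_equiv _ _ (.fromBlocks_compl he)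

theorem exists_cl_sub (x : KZero C) : ∃ e f : IdemMat C, x = cl e.e e.idem - cl f.e f.idem := by
  obtain ⟨⟨a, b⟩, h⟩ := (AddLocalization.addMonoidOf (⊤ : AddSubmonoid (IdemClass C))).surj x
  obtain ⟨e, rfl⟩ := IdemClass.exists_mk a
  obtain ⟨b, hb⟩ := b
  obtain ⟨f, rfl⟩ := IdemClass.exists_mk b
  exact ⟨e, f, eq_sub_of_add_eq h⟩

/-- Every element of `K₀` is the difference of an idempotent and a unit matrix. -/
theorem exists_cl_sub_one (x : KZero C) : ∃ (e : IdemMat C) (κ : Type) (_ : Fintype κ)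
    (_ : DecidableEq κ), x = cl e.e e.idem - cl (1 : Matrix κ κ C) (one_mul _) := by
  obtain ⟨e, f, rfl⟩ := exists_cl_sub x
  -- Adding `1 - f` to both terms completes the subtracted idempotent `f` to a unit matrix.
  refine ⟨e.sum ⟨f.ι, 1 - f.e, one_sub_idem f.idem⟩, f.ι, inferInstance, inferInstance, ?_⟩
  rw [IdemMat.sum, cl_fromBlocks _ _ e.idem (one_sub_idem f.idem), ← cl_add_compl f.e f.idem]
  abel

/-- Equality in the Grothendieck group means equality after adding some idempotent `g`; adding `1 -
g` as well turns the common summand into a unit matrix. -/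
theorem cl_eq_iff {e : Matrix ι ι C} {f : Matrix κ κ C} (he : e * e = e) (hf : f * f = f) :
    cl e he = cl f hf ↔ ∃ (μ : Type) (_ : Fintype μ) (_ : DecidableEq μ),
      MvEquiv (fromBlocks e 0 0 (1 : Matrix μ μ C)) (fromBlocks f 0 0 (1 : Matrix μ μ C)) := by
  constructor
  · intro h
    obtain ⟨⟨c, hc0⟩, hc⟩ :=
      (AddLocalization.addMonoidOf (⊤ : AddSubmonoid (IdemClass C))).eq_iff_exists.1 h
    obtain ⟨g, rfl⟩ := IdemClass.exists_mk c
    refine ⟨g.ι, inferInstance, inferInstance, ?_⟩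
    have h1 : IdemClass.mk (C := C) ⟨g.ι, 1, one_mul _⟩
        = IdemClass.mk g + IdemClass.mk ⟨g.ι, 1 - g.e, one_sub_idem g.idem⟩ :=
      IdemClass.mk_eq_iff.2 (MvEquiv.fromBlocks_compl g.idem).symm
    have hc' : IdemClass.mk g + IdemClass.mk ⟨ι, e, he⟩ = IdemClass.mk g + IdemClass.mk ⟨κ, f, hf⟩ :=
      hc
    have h2 : IdemClass.mk ⟨ι, e, he⟩ + IdemClass.mk ⟨g.ι, 1, one_mul _⟩
        = IdemClass.mk ⟨κ, f, hf⟩ + IdemClass.mk ⟨g.ι, 1, one_mul _⟩ := by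
      rw [h1, ← add_assoc, ← add_assoc, add_comm _ (IdemClass.mk g), hc',
        add_comm (IdemClass.mk g)]
    exact IdemClass.mk_eq_iff.1 h2
  · rintro ⟨μ, _, _, h⟩
    have := cl_eq_of_equiv (fromBlocks_idem he (one_mul _)) (fromBlocks_idem hf (one_mul _)) h
    rwa [cl_fromBlocks e _ he (one_mul _), cl_fromBlocks f _ hf (one_mul _), add_left_inj] at this

/-- Functoriality of `K₀`. -/
def map (φ : C →+* D) : KZero C →+ KZero D :=
  Algebra.GrothendieckAddGroup.lift (Algebra.GrothendieckAddGroup.of.comp (IdemClass.map φ))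

theorem map_cl (φ : C →+* D) (e : Matrix ι ι C) (he : e * e = e) :
    map φ (cl e he) = cl (e.map φ) (map_idem φ he) :=
  DFunLike.congr_fun (Algebra.GrothendieckAddGroup.lift.symm_apply_apply
    (Algebra.GrothendieckAddGroup.of.comp (IdemClass.map φ))) _

end KZero

end KZero

/-! ### Excision -/

section Excision

open Matrix

/-! ### Whitehead's lemma relative to an idempotent -/

section Rotation

variable {Λ Λ₀ ν : Type*} [Ring Λ] [Ring Λ₀] [Fintype ν] [DecidableEq ν]

/-- The matrix `X` agrees modulo the kernel of `π` with an invertible matrix in the commutant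
of `Q`. -/
def LiftsToCommutant (π : Λ →+* Λ₀) (Q X : Matrix ν ν Λ) : Prop :=
  ∃ Y Y' : Matrix ν ν Λ, Y * Y' = 1 ∧ Y' * Y = 1 ∧ Y * Q = Q * Y ∧ Y.map π = X.map π

theorem LiftsToCommutant.mul {π : Λ →+* Λ₀} {Q X X' : Matrix ν ν Λ}
    (h : LiftsToCommutant π Q X) (h' : LiftsToCommutant π Q X') :
    LiftsToCommutant π Q (X * X') := by
  obtain ⟨Y, Z, h1, h2, h3, h4⟩ := h
  obtain ⟨Y', Z', h1', h2', h3', h4'⟩ := h'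
  refine ⟨Y * Y', Z' * Z, ?_, ?_, ?_, ?_⟩
  · rw [Matrix.mul_assoc, ← Matrix.mul_assoc Y', h1', Matrix.one_mul, h1]
  · rw [Matrix.mul_assoc, ← Matrix.mul_assoc Z, h2, Matrix.one_mul, h2']
  · rw [Matrix.mul_assoc, h3', ← Matrix.mul_assoc, h3, Matrix.mul_assoc]
  · rw [Matrix.map_mul, Matrix.map_mul, h4, h4']

theorem map_fromBlocks_congr {Λ Λ₀ ν : Type*} [Ring Λ] [Ring Λ₀] (π : Λ →+* Λ₀) {a b c d a' b' c' d' : Matrix ν ν Λ}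
    (ha : a.map π = a'.map π) (hb : b.map π = b'.map π) (hc : c.map π = c'.map π)
    (hd : d.map π = d'.map π) :
    (fromBlocks a b c d).map π = (fromBlocks a' b' c' d').map π := by
  rw [fromBlocks_map, fromBlocks_map, ha, hb, hc, hd]

/-- A matrix that commutes with `p` agrees, modulo the kernel of `π`, with a matrix which
intertwines `e` and `f`. -/
theorem exists_intertwiner (π : Λ →+* Λ₀) {e f p m : Matrix ν ν Λ} (he : e * e = e)
    (hf : f * f = f) (hep : e.map π = p.map π) (hfp : f.map π = p.map π) (hm : m * p = p * m) :
    ∃ a : Matrix ν ν Λ, e * a = a * f ∧ a.map π = m.map π := by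
  -- Modulo the kernel of `π` this is `p m p + (1 - p) m (1 - p)`, which equals `m` because `m`
  -- commutes with `p`.
  refine ⟨e * m * f + (1 - e) * m * (1 - f), ?_, ?_⟩
  · simp only [mul_add, add_mul, mul_sub, sub_mul, Matrix.mul_assoc, hf, Matrix.one_mul,
      Matrix.mul_one]
    simp only [← Matrix.mul_assoc, he]
    abel
  · have h : π.mapMatrix (e * m * f + (1 - e) * m * (1 - f)) = π.mapMatrix m := by
      have h1 : π.mapMatrix e = π.mapMatrix p := hep
      have h2 : π.mapMatrix f = π.mapMatrix p := hfp
      have h3 : π.mapMatrix f * π.mapMatrix f = π.mapMatrix f := by rw [← map_mul, hf]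
      have h4 : π.mapMatrix m * π.mapMatrix p = π.mapMatrix p * π.mapMatrix m := by
        rw [← map_mul, hm, map_mul]
      rw [h2] at h3
      simp only [map_add, map_mul, map_sub, map_one, h1, h2]
      generalize π.mapMatrix p = P at *
      generalize π.mapMatrix m = M at *
      rw [← h4, mul_assoc, h3]
      simp only [mul_sub, sub_mul, one_mul, mul_one, ← h4, mul_assoc, h3]
      abel
    exact h

/-- An elementary matrix with off-diagonal entry `a` commutes with `diag(e, f)` as soon as `e a = a
f`, and it is invertible whatever `a` is. So only the entry has to be corrected modulo the kernel,
without any need to lift an inverse. -/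
theorem liftsToCommutant_upper (π : Λ →+* Λ₀) {e f p m : Matrix ν ν Λ} (he : e * e = e)
    (hf : f * f = f) (hep : e.map π = p.map π) (hfp : f.map π = p.map π) (hm : m * p = p * m) :
    LiftsToCommutant π (fromBlocks e 0 0 f) (fromBlocks 1 m 0 1) := by
  obtain ⟨a, ha, ham⟩ := exists_intertwiner π he hf hep hfp hm
  exact ⟨fromBlocks 1 a 0 1, fromBlocks 1 (-a) 0 1, by simp [fromBlocks_multiply],
    by simp [fromBlocks_multiply], by simp [fromBlocks_multiply, ha],
    map_fromBlocks_congr π rfl ham rfl rfl⟩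

theorem liftsToCommutant_lower (π : Λ →+* Λ₀) {e f p m : Matrix ν ν Λ} (he : e * e = e)
    (hf : f * f = f) (hep : e.map π = p.map π) (hfp : f.map π = p.map π) (hm : m * p = p * m) :
    LiftsToCommutant π (fromBlocks e 0 0 f) (fromBlocks 1 0 m 1) := by
  obtain ⟨a, ha, ham⟩ := exists_intertwiner π hf he hfp hep hm
  exact ⟨fromBlocks 1 0 a 1, fromBlocks 1 0 (-a) 1, by simp [fromBlocks_multiply],
    by simp [fromBlocks_multiply], by simp [fromBlocks_multiply, ha],
    map_fromBlocks_congr π rfl rfl ham rfl⟩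

/-- Whitehead's lemma: `diag(z, z⁻¹)` is a product of elementary matrices, hence lifts to the
commutant of `diag(e, f)` if `z` commutes with `p ≡ e ≡ f`. -/
theorem liftsToCommutant_rotation (π : Λ →+* Λ₀) {e f p z z' : Matrix ν ν Λ} (he : e * e = e)
    (hf : f * f = f) (hep : e.map π = p.map π) (hfp : f.map π = p.map π) (hz : z * p = p * z)
    (hz' : z' * p = p * z') (h1 : z * z' = 1) (h2 : z' * z = 1) :
    LiftsToCommutant π (fromBlocks e 0 0 f) (fromBlocks z 0 0 z') := by
  have up := fun {m : Matrix ν ν Λ} => liftsToCommutant_upper (m := m) π he hf hep hfp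
  have lo := fun {m : Matrix ν ν Λ} => liftsToCommutant_lower (m := m) π he hf hep hfp
  have hn : -z' * p = p * -z' := by rw [Matrix.neg_mul, hz', Matrix.mul_neg]
  -- The first three factors multiply to the block matrix with rows `(0, z)` and `(-z', 0)`, the
  -- last three to the one with rows `(0, -1)` and `(1, 0)`; their product is `diag(z, z')`.
  have h := (((up hz).mul (lo hn)).mul (up hz)).mul
    (((up (m := -1) (by simp)).mul (lo (m := 1) (by simp))).mul (up (m := -1) (by simp)))
  convert h using 1
  simp [fromBlocks_multiply, h1, h2]

end Rotation

/-- Two augmented rings `C → 𝕜` and `Λ → Λ₀` with the same augmentation ideal: the kernel of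
`π : Λ → Λ₀`, which is split by `s`, is contained in the subring `C` of `Λ`, whose image in `Λ₀`
is that of `𝕜`. -/
structure ExcisionData (C 𝕜 Λ Λ₀ : Type*) [Ring C] [Ring 𝕜] [Ring Λ] [Ring Λ₀] where
  ε : C →+* 𝕜
  η : 𝕜 →+* C
  π : Λ →+* Λ₀
  s : Λ₀ →+* Λ
  j : C →+* Λ
  q : 𝕜 →+* Λ₀
  π_s : ∀ x, π (s x) = x
  ε_η : ∀ z, ε (η z) = z
  π_j : ∀ c, π (j c) = q (ε c)
  j_η : ∀ z, j (η z) = s (q z)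
  j_injective : Function.Injective j
  exists_j : ∀ x z, π x = q z → ∃ c, j c = x

namespace ExcisionData

variable {C 𝕜 Λ Λ₀ : Type*} [Ring C] [Ring 𝕜] [Ring Λ] [Ring Λ₀] (D : ExcisionData C 𝕜 Λ Λ₀)

/-- The criterion by which all matrices over `C` are produced below: it suffices to compute the
image in `Λ₀` and to find it defined over `𝕜`. -/
theorem exists_map_j {ι κ : Type*} (A : Matrix ι κ Λ) (B : Matrix ι κ 𝕜)
    (h : A.map D.π = B.map D.q) : ∃ A' : Matrix ι κ C, A'.map D.j = A := by
  choose A' hA' using fun i k => D.exists_j (A i k) (B i k) (congrFun (congrFun h i) k)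
  exact ⟨.of A', by ext i k; exact hA' i k⟩

theorem map_j_injective {ι κ : Type*} :
    Function.Injective fun A : Matrix ι κ C => A.map D.j :=
  Matrix.map_injective D.j_injective

/-! ### Excision: comparing idempotents over the small ring -/

section Injective

variable {ν : Type} [Fintype ν] [DecidableEq ν]

/-- The conjugating matrix `z` need not come from `C`, since its image in `Λ₀` is arbitrary. With
`z̄ = s(π(z))` and `p` the common scalar part of `e` and `f`, the matrix `diag(z, z̄⁻¹)` conjugates
`diag(e, p)` to `diag(f, p)`. Its image in `Λ₀` lifts, by Whitehead's lemma, to an invertible `Y`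
commuting with `diag(e, p)`. Hence `diag(z, z̄⁻¹) Y⁻¹` effects the same conjugation and is congruent
to `1`, so it lies over `C`. -/
theorem cl_eq_of_conj {e f : Matrix ν ν C} (he : e * e = e) (hf : f * f = f)
    (hε : e.map D.ε = f.map D.ε) {z z' : Matrix ν ν Λ} (h1 : z * z' = 1) (h2 : z' * z = 1)
    (hz : z * e.map D.j = f.map D.j * z) : KZero.cl e he = KZero.cl f hf := by
  set pC : Matrix ν ν C := (e.map D.ε).map D.η with hpC
  have hpp : pC * pC = pC := KZero.map_idem _ (KZero.map_idem _ he)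
  set p : Matrix ν ν Λ := pC.map D.j with hp
  have hpj : p * p = p := KZero.map_idem _ hpp
  have hej := KZero.map_idem D.j he
  -- `σ` retracts `Λ` onto the copy of `Λ₀`; on matrices from `C` it is the scalar part, so both `e`
  -- and `f` go to `p`, and `σ z` commutes with `p`.
  let σ : Matrix ν ν Λ →+* Matrix ν ν Λ := (D.s.comp D.π).mapMatrix
  have hπσ : ∀ a : Matrix ν ν Λ, (σ a).map D.π = a.map D.π := fun a => by
    ext i k; exact D.π_s _
  have hσj : ∀ a : Matrix ν ν C, σ (a.map D.j) = ((a.map D.ε).map D.η).map D.j := fun a => by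
    ext i k
    change D.s (D.π (D.j (a i k))) = D.j (D.η (D.ε (a i k)))
    rw [D.π_j, D.j_η]
  have hσe : σ (e.map D.j) = p := hσj e
  have hσf : σ (f.map D.j) = p := by rw [hσj f, ← hε]
  have k1 : σ z * σ z' = 1 := by rw [← map_mul, h1, map_one]
  have k2 : σ z' * σ z = 1 := by rw [← map_mul, h2, map_one]
  have k3 : σ z * p = p * σ z := by
    conv_lhs => rw [← hσe]
    rw [← map_mul, hz, map_mul, hσf]
  have k4 : σ z' * p = p * σ z' := by
    calc σ z' * p = σ z' * p * (σ z * σ z') := by rw [k1, mul_one]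
      _ = σ z' * (p * σ z) * σ z' := by simp only [mul_assoc]
      _ = (σ z' * σ z) * p * σ z' := by rw [← k3]; simp only [mul_assoc]
      _ = p * σ z' := by rw [k2, one_mul]
  have hep : (e.map D.j).map D.π = p.map D.π := by rw [← hπσ, hσe]
  obtain ⟨Y, Y', y1, y2, y3, y4⟩ :=
    liftsToCommutant_rotation D.π hej hpj hep rfl k3 k4 k1 k2
  have hmap1 : (1 : Matrix (ν ⊕ ν) (ν ⊕ ν) Λ).map D.π = (1 : Matrix (ν ⊕ ν) (ν ⊕ ν) 𝕜).map D.q := by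
    rw [Matrix.map_one _ (map_zero _) (map_one _), Matrix.map_one _ (map_zero _) (map_one _)]
  have y4' : Y.map D.π = (fromBlocks z 0 0 (σ z')).map D.π :=
    y4.trans (map_fromBlocks_congr _ (hπσ z) rfl rfl rfl)
  -- The corrected matrix and its inverse both become `1` in `Λ₀`, so both descend to `C`; they are
  -- `V` and `V'` below.
  have hW : (fromBlocks z 0 0 (σ z') * Y').map D.π = (1 : Matrix (ν ⊕ ν) (ν ⊕ ν) 𝕜).map D.q := by
    rw [Matrix.map_mul, ← y4', ← Matrix.map_mul, y1, hmap1]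
  have hW' : (Y * fromBlocks z' 0 0 (σ z)).map D.π = (1 : Matrix (ν ⊕ ν) (ν ⊕ ν) 𝕜).map D.q := by
    rw [Matrix.map_mul, y4', ← Matrix.map_mul, fromBlocks_multiply]
    simp only [h1, k2, Matrix.mul_zero, Matrix.zero_mul, add_zero, zero_add, fromBlocks_one, hmap1]
  obtain ⟨V, hV⟩ := D.exists_map_j _ _ hW
  obtain ⟨V', hV'⟩ := D.exists_map_j _ _ hW'
  have hzz : fromBlocks z 0 0 (σ z') * fromBlocks z' 0 0 (σ z) = 1 := by
    simp [fromBlocks_multiply, h1, k2]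
  have hzz' : fromBlocks z' 0 0 (σ z) * fromBlocks z 0 0 (σ z') = 1 := by
    simp [fromBlocks_multiply, h2, k1]
  have v1 : V * V' = 1 := D.map_j_injective (by
    simp only [Matrix.map_mul, hV, hV', Matrix.map_one _ (map_zero D.j) (map_one D.j)]
    rw [Matrix.mul_assoc, ← Matrix.mul_assoc Y', y2, Matrix.one_mul, hzz])
  have v2 : V' * V = 1 := D.map_j_injective (by
    simp only [Matrix.map_mul, hV, hV', Matrix.map_one _ (map_zero D.j) (map_one D.j)]
    rw [Matrix.mul_assoc, ← Matrix.mul_assoc (fromBlocks z' 0 0 (σ z)), hzz', Matrix.one_mul, y1])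
  have y3' : Y' * fromBlocks (e.map D.j) 0 0 p = fromBlocks (e.map D.j) 0 0 p * Y' := by
    calc Y' * fromBlocks (e.map D.j) 0 0 p
        = Y' * (fromBlocks (e.map D.j) 0 0 p * Y) * Y' := by
          rw [Matrix.mul_assoc, Matrix.mul_assoc, y1, Matrix.mul_one]
      _ = (Y' * Y) * fromBlocks (e.map D.j) 0 0 p * Y' := by rw [← y3]; simp only [Matrix.mul_assoc]
      _ = fromBlocks (e.map D.j) 0 0 p * Y' := by rw [y2, Matrix.one_mul]
  have hblock : ∀ a : Matrix ν ν C,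
      (fromBlocks a 0 0 pC).map D.j = fromBlocks (a.map D.j) 0 0 p := fun a => by
    rw [fromBlocks_map, Matrix.map_zero _ (map_zero D.j)]
  have v3 : V * fromBlocks e 0 0 pC = fromBlocks f 0 0 pC * V := D.map_j_injective (by
    simp only [Matrix.map_mul, hV, hblock]
    rw [Matrix.mul_assoc, y3', ← Matrix.mul_assoc, ← Matrix.mul_assoc]
    congr 1
    simp [fromBlocks_multiply, hz, k4])
  have hE := KZero.fromBlocks_idem he hpp
  have hF := KZero.fromBlocks_idem hf hpp
  have key := KZero.cl_eq_of_equiv hE hF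
    ⟨fromBlocks e 0 0 pC * V', V * fromBlocks e 0 0 pC, by
      rw [Matrix.mul_assoc, ← Matrix.mul_assoc V', v2, Matrix.one_mul, hE], by
      rw [Matrix.mul_assoc, ← Matrix.mul_assoc (fromBlocks e 0 0 pC), hE, ← Matrix.mul_assoc, v3,
        Matrix.mul_assoc, v1, Matrix.mul_one]⟩
  rwa [KZero.cl_fromBlocks _ _ he hpp, KZero.cl_fromBlocks _ _ hf hpp, add_left_inj] at key

/-- Equivalent idempotents become conjugate after adding a zero block of the same size: for
normalised `x`, `y`, the block matrix with rows `(y, 1 - f)` and `(1 - e, x)` is invertible and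
carries `diag(e, 0)` to `diag(f, 0)`. -/
theorem cl_eq_of_equiv {e f : Matrix ν ν C} (he : e * e = e) (hf : f * f = f)
    (hε : e.map D.ε = f.map D.ε) (h : MvEquiv (e.map D.j) (f.map D.j)) :
    KZero.cl e he = KZero.cl f hf := by
  have hej := KZero.map_idem D.j he
  have hfj := KZero.map_idem D.j hf
  obtain ⟨x, y, h1, h2, h3, h4, h5, h6⟩ := h.exists_normal hej hfj
  have hE := KZero.fromBlocks_idem he (zero_mul (0 : Matrix ν ν C))
  have hF := KZero.fromBlocks_idem hf (zero_mul (0 : Matrix ν ν C))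
  have hz : ∀ {R : Type _} [Ring R] (φ : C →+* R) (a : Matrix ν ν C),
      (fromBlocks a 0 0 (0 : Matrix ν ν C)).map φ = fromBlocks (a.map φ) 0 0 0 := fun φ a => by
    rw [fromBlocks_map, Matrix.map_zero _ (map_zero φ)]
  have hz' : ∀ (a : Matrix ν ν C),
      (fromBlocks a 0 0 (0 : Matrix ν ν C)).map D.ε = fromBlocks (a.map D.ε) 0 0 0 := fun a => by
    rw [fromBlocks_map, Matrix.map_zero _ (map_zero D.ε)]
  have key := D.cl_eq_of_conj hE hF (by rw [hz', hz', hε])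
    (z := fromBlocks y (1 - f.map D.j) (1 - e.map D.j) x)
    (z' := fromBlocks x (1 - e.map D.j) (1 - f.map D.j) y)
    (by simp [fromBlocks_multiply, mul_sub, sub_mul, hej, hfj, h1, h2, h3, h4, h5, h6])
    (by simp [fromBlocks_multiply, mul_sub, sub_mul, hej, hfj, h1, h2, h3, h4, h5, h6])
    (by rw [hz, hz]; simp [fromBlocks_multiply, mul_sub, sub_mul, hej, hfj, h5, h6])
  rwa [KZero.cl_fromBlocks _ _ he (zero_mul _), KZero.cl_fromBlocks _ _ hf (zero_mul _),
    add_left_inj] at key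

/-- Equality of classes over `Λ` is equivalence after adding a unit matrix, and that matrix is
already defined over `C`. -/
theorem cl_eq_of_cl_map_eq {e f : Matrix ν ν C} (he : e * e = e) (hf : f * f = f)
    (hε : e.map D.ε = f.map D.ε)
    (h : KZero.cl (e.map D.j) (KZero.map_idem _ he) = KZero.cl (f.map D.j) (KZero.map_idem _ hf)) :
    KZero.cl e he = KZero.cl f hf := by
  obtain ⟨μ, _, _, h⟩ := (KZero.cl_eq_iff _ _).1 h
  have hone : ∀ {R : Type _} [Ring R] (φ : C →+* R) (a : Matrix ν ν C),
      (fromBlocks a 0 0 (1 : Matrix μ μ C)).map φ = fromBlocks (a.map φ) 0 0 1 := fun φ a => by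
    rw [fromBlocks_map, Matrix.map_zero _ (map_zero φ), Matrix.map_zero _ (map_zero φ),
      Matrix.map_one _ (map_zero φ) (map_one φ)]
  have hone' : ∀ (a : Matrix ν ν C),
      (fromBlocks a 0 0 (1 : Matrix μ μ C)).map D.ε = fromBlocks (a.map D.ε) 0 0 1 := fun a => by
    rw [fromBlocks_map, Matrix.map_zero _ (map_zero D.ε), Matrix.map_zero _ (map_zero D.ε),
      Matrix.map_one _ (map_zero D.ε) (map_one D.ε)]
  have key := D.cl_eq_of_equiv (KZero.fromBlocks_idem he (one_mul (1 : Matrix μ μ C)))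
    (KZero.fromBlocks_idem hf (one_mul (1 : Matrix μ μ C))) (by rw [hone', hone', hε])
    (by rw [hone, hone]; exact h)
  rwa [KZero.cl_fromBlocks _ _ he (one_mul _), KZero.cl_fromBlocks _ _ hf (one_mul _),
    add_left_inj] at key

end Injective

/-! ### Excision: the isomorphism of kernels -/

theorem map_comp_apply {A B E : Type*} [Ring A] [Ring B] [Ring E] (φ : A →+* B) (ψ : B →+* E)
    (x : KZero A) : KZero.map ψ (KZero.map φ x) = KZero.map (ψ.comp φ) x := by
  obtain ⟨e, f, rfl⟩ := KZero.exists_cl_sub x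
  simp only [map_sub, KZero.map_cl]
  rfl

theorem map_π_map_j (x : KZero C) :
    KZero.map D.π (KZero.map D.j x) = KZero.map D.q (KZero.map D.ε x) := by
  rw [map_comp_apply, map_comp_apply]
  congr 1
  exact congrArg _ (RingHom.ext D.π_j)

/-- The comparison above wants idempotents of one size with literally equal augmentations. If `x =
[e] - [f]` and `e₀`, `f₀` are the scalar parts, then `[e₀] = [f₀]`, so `e ⊕ f₀` and `e₀ ⊕ f` have
classes differing by `x`, and both have augmentation `ε(e) ⊕ ε(f)`. -/
theorem map_j_injOn {x : KZero C} (hε : KZero.map D.ε x = 0) (hj : KZero.map D.j x = 0) :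
    x = 0 := by
  obtain ⟨e, f, rfl⟩ := KZero.exists_cl_sub x
  have he₀ := KZero.map_idem D.η (KZero.map_idem D.ε e.idem)
  have hf₀ := KZero.map_idem D.η (KZero.map_idem D.ε f.idem)
  have h0 := congrArg (KZero.map D.η) hε
  rw [map_sub, map_sub, map_zero, KZero.map_cl, KZero.map_cl, KZero.map_cl, KZero.map_cl,
    sub_eq_zero] at h0
  have hE := KZero.fromBlocks_idem e.idem hf₀
  have hF := KZero.fromBlocks_idem he₀ f.idem
  have key := D.cl_eq_of_cl_map_eq hE hF (by
      simp only [fromBlocks_map, Matrix.map_map, Matrix.map_zero _ (map_zero D.ε)]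
      congr 1 <;> ext i k <;> exact (by first | exact (D.ε_η _).symm | exact D.ε_η _)) (by
    rw [← KZero.map_cl D.j _ hE, ← KZero.map_cl D.j _ hF, KZero.cl_fromBlocks _ _ e.idem hf₀,
      KZero.cl_fromBlocks _ _ he₀ f.idem, h0, map_add, map_add]
    rw [map_sub, sub_eq_zero] at hj
    rw [hj, add_comm])
  rw [KZero.cl_fromBlocks _ _ e.idem hf₀, KZero.cl_fromBlocks _ _ he₀ f.idem, h0, add_comm,
    add_right_inj] at key
  rw [key, sub_self]

/-- After stabilisation, `k` is represented by an idempotent whose image in `Λ₀` is equivalent to a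
unit matrix. The splitting `s` lifts that equivalence to `Λ`, where it yields an invertible matrix;
conjugating by it makes the image in `Λ₀` scalar, so the conjugated idempotent is defined over `C`.
-/
theorem exists_map_j_eq {k : KZero Λ} (hk : KZero.map D.π k = 0) :
    ∃ x : KZero C, KZero.map D.ε x = 0 ∧ KZero.map D.j x = k := by
  obtain ⟨e, κ, _, _, rfl⟩ := KZero.exists_cl_sub_one k
  rw [map_sub, sub_eq_zero, KZero.map_cl, KZero.map_cl] at hk
  obtain ⟨μ, _, _, x, y, hxy, hyx⟩ := (KZero.cl_eq_iff _ _).1 hk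
  rw [Matrix.map_one _ (map_zero _) (map_one _), fromBlocks_one] at hyx
  set E : Matrix (e.ι ⊕ μ) (e.ι ⊕ μ) Λ := fromBlocks e.e 0 0 1 with hE
  have hEE : E * E = E := KZero.fromBlocks_idem e.idem (one_mul _)
  have hEmap : E.map D.π = x * y := by
    rw [hxy, hE, fromBlocks_map, Matrix.map_zero _ (map_zero _), Matrix.map_zero _ (map_zero _),
      Matrix.map_one _ (map_zero _) (map_one _)]
  set X := x.map D.s
  set Y := y.map D.s
  have hYX : Y * X = 1 := by
    rw [← Matrix.map_mul, hyx, Matrix.map_one _ (map_zero _) (map_one _)]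
  -- Since `Y X = 1`, this is an involution; it exchanges `diag(X Y, 0)` and `diag(0, 1)`.
  set z : Matrix ((e.ι ⊕ μ) ⊕ (κ ⊕ μ)) ((e.ι ⊕ μ) ⊕ (κ ⊕ μ)) Λ :=
    fromBlocks (1 - X * Y) X Y 0 with hz
  have hYXY : Y * (X * Y) = Y := by rw [← Matrix.mul_assoc, hYX, Matrix.one_mul]
  have hzz : z * z = 1 := by
    simp [hz, fromBlocks_multiply, mul_sub, sub_mul, Matrix.mul_assoc, Matrix.mul_sub,
      Matrix.sub_mul, hYX, hYXY]
  have hE0 := KZero.fromBlocks_idem hEE (zero_mul (0 : Matrix (κ ⊕ μ) (κ ⊕ μ) Λ))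
  set F := fromBlocks E 0 0 (0 : Matrix (κ ⊕ μ) (κ ⊕ μ) Λ) with hF
  have hzF : (z * F * z).map D.π
      = (fromBlocks 0 0 0 1 : Matrix ((e.ι ⊕ μ) ⊕ (κ ⊕ μ)) ((e.ι ⊕ μ) ⊕ (κ ⊕ μ)) 𝕜).map D.q := by
    have hXπ : X.map D.π = x := by ext i k; exact D.π_s _
    have hYπ : Y.map D.π = y := by ext i k; exact D.π_s _
    have hyxy : y * (x * y) = y := by rw [← Matrix.mul_assoc, hyx, Matrix.one_mul]
    have hzπ : z.map D.π = fromBlocks (1 - x * y) x y 0 := by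
      rw [hz, fromBlocks_map, hXπ, hYπ, Matrix.map_sub _ (map_sub _), Matrix.map_mul, hXπ, hYπ,
        Matrix.map_zero _ (map_zero _), Matrix.map_one _ (map_zero _) (map_one _)]
    have hFπ : F.map D.π = fromBlocks (x * y) 0 0 0 := by
      rw [hF, fromBlocks_map, hEmap]
      simp only [Matrix.map_zero _ (map_zero D.π)]
    rw [Matrix.map_mul, Matrix.map_mul, hzπ, hFπ, fromBlocks_map]
    simp only [Matrix.map_zero _ (map_zero D.q), Matrix.map_one _ (map_zero D.q) (map_one D.q)]
    simp [fromBlocks_multiply, Matrix.mul_sub, Matrix.sub_mul, Matrix.mul_assoc, hyx, hyxy]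
  obtain ⟨e', he'⟩ := D.exists_map_j _ _ hzF
  have hG : z * F * z * (z * F * z) = z * F * z := by
    calc z * F * z * (z * F * z) = z * F * (z * z) * F * z := by simp only [Matrix.mul_assoc]
      _ = z * F * z := by rw [hzz, Matrix.mul_one, Matrix.mul_assoc z F F, hE0]
  have hidem : e' * e' = e' := D.map_j_injective (by
    simp only [Matrix.map_mul]
    rw [he', hG])
  have hidem₀ := KZero.map_idem D.η (KZero.map_idem D.ε hidem)
  have hB := KZero.fromBlocks_idem (zero_mul (0 : Matrix (e.ι ⊕ μ) (e.ι ⊕ μ) Λ))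
    (one_mul (1 : Matrix (κ ⊕ μ) (κ ⊕ μ) Λ))
  have h0 : ((e'.map D.ε).map D.η).map D.j
      = fromBlocks 0 0 0 (1 : Matrix (κ ⊕ μ) (κ ⊕ μ) Λ) := by
    have h1 : ((e'.map D.ε).map D.η).map D.j = ((e'.map D.j).map D.π).map D.s := by
      ext i k
      change D.j (D.η (D.ε (e' i k))) = D.s (D.π (D.j (e' i k)))
      rw [D.π_j, D.j_η]
    rw [h1, he', hzF]
    simp only [fromBlocks_map, Matrix.map_zero _ (map_zero D.q), Matrix.map_zero _ (map_zero D.s),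
      Matrix.map_one _ (map_zero D.q) (map_one D.q), Matrix.map_one _ (map_zero D.s) (map_one D.s)]
  -- Subtracting the scalar part makes the augmentation vanish. Over `Λ`, `e'` is conjugate to `e ⊕
  -- 1_μ ⊕ 0`, and its scalar part is `0 ⊕ 1_κ ⊕ 1_μ`; the terms `[1_μ]` cancel.
  refine ⟨KZero.cl e' hidem - KZero.cl _ hidem₀, ?_, ?_⟩
  · rw [map_sub, KZero.map_cl, KZero.map_cl, sub_eq_zero]
    congr 1
    ext i k
    exact (D.ε_η _).symm
  · have c1 : KZero.cl (e'.map D.j) (KZero.map_idem D.j hidem) = KZero.cl F hE0 := by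
      refine KZero.cl_eq_of_equiv _ _ ⟨z * F, F * z, ?_, ?_⟩
      · rw [he', Matrix.mul_assoc, ← Matrix.mul_assoc F F, hE0, Matrix.mul_assoc]
      · rw [Matrix.mul_assoc, ← Matrix.mul_assoc z z, hzz, Matrix.one_mul, hE0]
    have c2 : KZero.cl (((e'.map D.ε).map D.η).map D.j) (KZero.map_idem D.j hidem₀)
        = KZero.cl _ hB := by
      congr 1
    have c3 : KZero.cl (1 : Matrix (κ ⊕ μ) (κ ⊕ μ) Λ) (one_mul _)
        = KZero.cl (1 : Matrix κ κ Λ) (one_mul _) + KZero.cl (1 : Matrix μ μ Λ) (one_mul _) := by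
      rw [← KZero.cl_fromBlocks _ _ _ _ (KZero.fromBlocks_idem (one_mul _) (one_mul _))]
      congr 1
      rw [fromBlocks_one]
    rw [map_sub, KZero.map_cl, KZero.map_cl, c1, c2, KZero.cl_fromBlocks _ _ hEE (zero_mul _),
      KZero.cl_fromBlocks (0 : Matrix (e.ι ⊕ μ) (e.ι ⊕ μ) Λ) (1 : Matrix (κ ⊕ μ) (κ ⊕ μ) Λ)
        (zero_mul _) (one_mul _), KZero.cl_zero, KZero.cl_zero, c3,
      KZero.cl_fromBlocks _ _ e.idem (one_mul _)]
    abel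

/-- Excision: `K₀(C → 𝕜)` and `K₀(Λ → Λ₀)` agree. -/
theorem nonempty_ker_equiv :
    Nonempty ((KZero.map D.ε).ker ≃+ (KZero.map D.π).ker) := by
  refine ⟨AddEquiv.ofBijective (((KZero.map D.j).comp (KZero.map D.ε).ker.subtype).codRestrict
    (KZero.map D.π).ker fun x => ?_) ⟨?_, ?_⟩⟩
  · rw [AddMonoidHom.mem_ker, AddMonoidHom.comp_apply, map_π_map_j]
    exact (congrArg _ x.2).trans (map_zero _)
  · rw [injective_iff_map_eq_zero]
    intro x hx
    exact Subtype.ext (D.map_j_injOn x.2 (congrArg Subtype.val hx))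
  · rintro ⟨k, hk⟩
    obtain ⟨x, h1, h2⟩ := D.exists_map_j_eq hk
    exact ⟨⟨x, h1⟩, Subtype.ext h2⟩

end ExcisionData

end Excision

/-! ### Equivariant modules and invariant matrices -/

section EquivariantModules

open Matrix

variable {G : Type} [Group G] {R : Type v} [Ring R] [Algebra ℂ R] {θ : G →* (R →ₐ[ℂ] R)}

/-- Equivariance of a linear map between equivariant modules. -/
def IsEquivariant (E F : EquivModule.{u} θ) (f : E.carrier →ₗ[R] F.carrier) : Prop :=
  ∀ g e, f (E.act g e) = F.act g (f e)

theorem IsEquivariant.comp {E F K : EquivModule.{u} θ} {f : F.carrier →ₗ[R] K.carrier}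
    {f' : E.carrier →ₗ[R] F.carrier} (h : IsEquivariant F K f) (h' : IsEquivariant E F f') :
    IsEquivariant E K (f ∘ₗ f') := fun g e => by
  rw [LinearMap.comp_apply, h' g e, h g]; rfl

theorem EquivModule.act_inv_act (E : EquivModule.{u} θ) (g : G) (e : E.carrier) :
    E.act g⁻¹ (E.act g e) = e := by
  rw [← E.act_mul, inv_mul_cancel, E.act_one]

theorem EquivModule.act_act_inv (E : EquivModule.{u} θ) (g : G) (e : E.carrier) :
    E.act g (E.act g⁻¹ e) = e := by
  rw [← E.act_mul, mul_inv_cancel, E.act_one]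

/-- The conjugate of a linear map by a group element. -/
def conjLinear (E F : EquivModule.{u} θ) (f : E.carrier →ₗ[R] F.carrier) (g : G) :
    E.carrier →ₗ[R] F.carrier where
  toFun e := F.act g (f (E.act g⁻¹ e))
  map_add' e e' := by simp only [map_add]
  map_smul' r e := by
    have h : θ g (θ g⁻¹ r) = r := by
      rw [← AlgHom.mul_apply, ← map_mul, mul_inv_cancel, map_one, AlgHom.one_apply]
    rw [E.act_smul, map_smul, F.act_smul, h, RingHom.id_apply]

/-- Multiplication by a complex number, as a linear map. -/
def scalarLinear (R : Type v) [Ring R] [Algebra ℂ R] (E : Type u) [AddCommGroup E] [Module R E]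
    (c : ℂ) : E →ₗ[R] E where
  toFun e := algebraMap ℂ R c • e
  map_add' := smul_add _
  map_smul' r e := by
    rw [smul_smul, RingHom.id_apply, smul_smul, Algebra.commutes]

/-- Averaging over a finite group turns a linear section of an equivariant map into an
equivariant one. -/
theorem exists_equivariant_section [Finite G] {E F : EquivModule.{u} θ}
    {p : F.carrier →ₗ[R] E.carrier}
    (hp : IsEquivariant F E p) {s : E.carrier →ₗ[R] F.carrier} (hs : p ∘ₗ s = LinearMap.id) :
    ∃ s' : E.carrier →ₗ[R] F.carrier, IsEquivariant E F s' ∧ p ∘ₗ s' = LinearMap.id := by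
  have := Fintype.ofFinite G
  have hcard : (Fintype.card G : ℂ) ≠ 0 := by exact_mod_cast Fintype.card_ne_zero
  -- As `p` is equivariant, each conjugate of `s` is again a section, so the mean is one too. The
  -- scalar `1 / |G|` is fixed by `θ` and central in `R`, hence compatible with both structures.
  refine ⟨scalarLinear R F.carrier (Fintype.card G : ℂ)⁻¹ ∘ₗ ∑ g, conjLinear E F s g, ?_, ?_⟩
  · intro k e
    have h : ∑ g, conjLinear E F s g (E.act k e) = F.act k (∑ g, conjLinear E F s g e) := by
      rw [map_sum, ← Equiv.sum_comp (Equiv.mulLeft k)]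
      refine Finset.sum_congr rfl fun g _ => ?_
      change F.act (k * g) (s (E.act (k * g)⁻¹ (E.act k e))) = F.act k (F.act g (s (E.act g⁻¹ e)))
      rw [F.act_mul, _root_.mul_inv_rev, E.act_mul, E.act_inv_act]
    simp only [LinearMap.comp_apply, LinearMap.sum_apply, h]
    change algebraMap ℂ R _ • F.act k _ = F.act k (algebraMap ℂ R _ • _)
    rw [F.act_smul, AlgHom.commutes]
  · refine LinearMap.ext fun e => ?_
    have h : ∀ g, p (conjLinear E F s g e) = e := fun g => by
      change p (F.act g (s (E.act g⁻¹ e))) = e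
      have := LinearMap.congr_fun hs (E.act g⁻¹ e)
      rw [LinearMap.comp_apply, LinearMap.id_apply] at this
      rw [hp, this, E.act_act_inv]
    simp only [LinearMap.comp_apply, LinearMap.sum_apply, LinearMap.id_apply]
    change p (algebraMap ℂ R _ • _) = e
    rw [map_smul, map_sum, Finset.sum_congr rfl fun g _ => h g, Finset.sum_const, Finset.card_univ,
      ← Nat.cast_smul_eq_nsmul R, smul_smul, ← map_natCast (algebraMap ℂ R), ← map_mul,
      inv_mul_cancel₀ hcard, map_one, one_smul]

/-- The power `F^ι` of an equivariant module. -/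
def EquivModule.pow (F : EquivModule.{u} θ) (ι : Type) [Fintype ι] : EquivModule.{u} θ where
  carrier := ι → F.carrier
  projective := Module.Projective.of_equiv (DFinsupp.linearEquivFunOnFintype (R := R) (ι := ι)
    (M := fun _ => F.carrier))
  act g := (F.act g).compLeft ι
  act_one v := funext fun i => F.act_one (v i)
  act_mul g h v := funext fun i => F.act_mul g h (v i)
  act_smul g r v := funext fun i => F.act_smul g r (v i)

/-- An equivariant submodule which is a retract is an equivariant module. -/
def EquivModule.ofRetract (F : EquivModule.{u} θ) (p : F.carrier →ₗ[R] F.carrier)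
    (hp : IsEquivariant F F p) (hpp : p ∘ₗ p = p) : EquivModule.{u} θ where
  carrier := LinearMap.range p
  finite := Module.Finite.range p
  projective := Module.Projective.of_split (LinearMap.range p).subtype p.rangeRestrict (by
    refine LinearMap.ext ?_
    rintro ⟨_, x, rfl⟩
    exact Subtype.ext (LinearMap.congr_fun hpp x))
  act g :=
    { toFun := fun x => ⟨F.act g x.1, by
        obtain ⟨_, y, rfl⟩ := x
        exact ⟨F.act g y, hp g y⟩⟩
      map_zero' := Subtype.ext (map_zero _)
      map_add' := fun x y => Subtype.ext (map_add _ _ _) }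
  act_one x := Subtype.ext (F.act_one x.1)
  act_mul g h x := Subtype.ext (F.act_mul g h x.1)
  act_smul g r x := Subtype.ext (F.act_smul g r x.1)

variable [Fintype G] [DecidableEq G]

variable (θ) in
/-- The ring of `G × G` matrices over `R` that are invariant under `G`; it is isomorphic to the
crossed product of `R` by `G`. -/
def invMat : Subring (Matrix G G R) where
  carrier := {a | ∀ g h k, a (g * h) (g * k) = θ g (a h k)}
  mul_mem' {a b} ha hb g h k := by
    rw [Matrix.mul_apply, Matrix.mul_apply, map_sum, ← Equiv.sum_comp (Equiv.mulLeft g)]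
    exact Finset.sum_congr rfl fun l _ => by rw [map_mul, ← ha, ← hb]; rfl
  one_mem' g h k := by
    simp only [Matrix.one_apply, mul_right_inj]
    split_ifs <;> simp
  add_mem' {a b} ha hb g h k := by
    rw [Matrix.add_apply, ha, hb, Matrix.add_apply, map_add]
  zero_mem' g h k := by simp
  neg_mem' {a} ha g h k := by
    rw [Matrix.neg_apply, ha, Matrix.neg_apply, map_neg]

/-- A basis permuted simply transitively by `G`. -/
structure RegularBasis (F : EquivModule.{u} θ) where
  b : Module.Basis G R F.carrier
  act_b : ∀ g h, F.act g (b h) = b (g * h)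

variable (θ) in
/-- The regular equivariant module. -/
def regularModule : EquivModule.{max u v} θ where
  carrier := ULift.{u} (G → R)
  act g :=
    { toFun := fun x => ⟨fun k => θ g (x.down (g⁻¹ * k))⟩
      map_zero' := by ext; simp
      map_add' := fun x y => by ext; simp }
  act_one x := by ext; simp
  act_mul g h x := by ext; simp [mul_assoc]
  act_smul g r x := by ext; simp

variable (θ) in
/-- The standard basis of the regular module. -/
def regularBasis : RegularBasis (regularModule.{u} θ) where
  b := (Pi.basisFun R G).map ULift.moduleEquiv.symm
  act_b g h := by
    refine ULift.ext _ _ (funext fun k => ?_)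
    change θ g ((Pi.basisFun R G h) (g⁻¹ * k)) = Pi.basisFun R G (g * h) k
    simp only [Pi.basisFun_apply, Pi.single_apply, inv_mul_eq_iff_eq_mul]
    split_ifs <;> simp

/-! ### Equivariant maps of regular modules as matrices -/

namespace RegularBasis

variable {F : EquivModule.{u} θ} (B : RegularBasis F)

omit [DecidableEq G] in
theorem isEquivariant_of_basis {E : EquivModule.{u} θ} {f : F.carrier →ₗ[R] E.carrier}
    (h : ∀ g k, f (B.b (g * k)) = E.act g (f (B.b k))) : IsEquivariant F E f := fun g v => by
  conv_lhs => rw [← B.b.sum_repr v]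
  conv_rhs => rw [← B.b.sum_repr v]
  simp only [map_sum, F.act_smul, B.act_b, map_smul, E.act_smul, h]

/-- The equivariant map from the regular module that takes a given value at the basis vector `1`. -/
def lift (E : EquivModule.{u} θ) (x : E.carrier) : F.carrier →ₗ[R] E.carrier :=
  B.b.constr ℕ fun h => E.act h x

omit [Fintype G] [DecidableEq G] in
theorem lift_b (E : EquivModule.{u} θ) (x : E.carrier) (h : G) :
    B.lift E x (B.b h) = E.act h x := B.b.constr_basis ℕ _ h

omit [DecidableEq G] in
theorem isEquivariant_lift (E : EquivModule.{u} θ) (x : E.carrier) :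
    IsEquivariant F E (B.lift E x) :=
  B.isEquivariant_of_basis fun g k => by rw [lift_b, lift_b, E.act_mul]

/-- The operator on the regular module defined by an invariant matrix. -/
def op : invMat θ →+ (F.carrier →ₗ[R] F.carrier) where
  toFun a := B.b.constr ℕ fun h => ∑ k, a.1 h k • B.b k
  map_zero' := B.b.ext fun h => by simp
  map_add' a a' := B.b.ext fun h => by
    simp [add_smul, Finset.sum_add_distrib]

theorem op_b (a : invMat θ) (h : G) : B.op a (B.b h) = ∑ k, a.1 h k • B.b k :=
  B.b.constr_basis ℕ _ h

/-- Row `h` of the matrix holds the coordinates of the image of `b h`. Over a noncommutative ring,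
operators on a left module thus multiply coordinate rows on the right, which reverses composition.
-/
theorem op_mul (a a' : invMat θ) : B.op (a * a') = B.op a' ∘ₗ B.op a := B.b.ext fun h => by
  simp only [op_b, LinearMap.comp_apply, map_sum, map_smul, Finset.smul_sum, smul_smul]
  rw [Finset.sum_comm]
  refine Finset.sum_congr rfl fun k _ => ?_
  rw [← Finset.sum_smul]
  rfl

theorem isEquivariant_op (a : invMat θ) : IsEquivariant F F (B.op a) :=
  B.isEquivariant_of_basis fun g k => by
    rw [op_b, op_b, map_sum, ← Equiv.sum_comp (Equiv.mulLeft g)]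
    refine Finset.sum_congr rfl fun l _ => ?_
    rw [F.act_smul, B.act_b, ← a.2]
    rfl

/-- Invariance of the coordinate matrix is exactly equivariance, since `g` carries `b h` to `b (g *
h)` and acts on coefficients by `θ g`. -/
theorem exists_op {f : F.carrier →ₗ[R] F.carrier} (hf : IsEquivariant F F f) :
    ∃ a, B.op a = f := by
  refine ⟨⟨fun h k => B.b.repr (f (B.b h)) k, fun g h k => ?_⟩, B.b.ext fun h => ?_⟩
  · have h1 : f (B.b (g * h)) = ∑ l, θ g (B.b.repr (f (B.b h)) l) • B.b (g * l) := by
      rw [← B.act_b, hf]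
      conv_lhs => rw [← B.b.sum_repr (f (B.b h))]
      simp only [map_sum, F.act_smul, B.act_b]
    have h2 : ∑ l, θ g (B.b.repr (f (B.b h)) l) • B.b (g * l)
        = ∑ l, θ g (B.b.repr (f (B.b h)) (g⁻¹ * l)) • B.b l := by
      rw [← Equiv.sum_comp (Equiv.mulLeft g)
        fun l => θ g (B.b.repr (f (B.b h)) (g⁻¹ * l)) • B.b l]
      simp
    change B.b.repr (f (B.b (g * h))) (g * k) = θ g (B.b.repr (f (B.b h)) k)
    rw [h1, h2, B.b.repr_sum_self]
    simp
  · rw [op_b]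
    exact B.b.sum_repr _

theorem op_injective : Function.Injective B.op := fun a a' h => by
  refine Subtype.ext (Matrix.ext fun i k => ?_)
  have h1 := congrArg (fun f : F.carrier →ₗ[R] F.carrier => B.b.repr (f (B.b i)) k) h
  simpa only [op_b, B.b.repr_sum_self] using h1

variable {ι κ μ : Type} [Fintype ι] [Fintype κ] [Fintype μ]

/-- The operator `F^ι → F^κ` defined by a matrix of invariant matrices. -/
def opMat (x : Matrix ι κ (invMat θ)) : (ι → F.carrier) →ₗ[R] (κ → F.carrier) :=
  LinearMap.pi fun c => ∑ a, B.op (x a c) ∘ₗ LinearMap.proj a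

omit [Fintype κ] in
theorem opMat_apply (x : Matrix ι κ (invMat θ)) (v : ι → F.carrier) (c : κ) :
    B.opMat x v c = ∑ a, B.op (x a c) (v a) := by
  simp [opMat]

omit [Fintype μ] in
theorem opMat_mul (x : Matrix ι κ (invMat θ)) (y : Matrix κ μ (invMat θ)) :
    B.opMat (x * y) = B.opMat y ∘ₗ B.opMat x := by
  refine LinearMap.ext fun v => funext fun d => ?_
  simp only [LinearMap.comp_apply, opMat_apply, Matrix.mul_apply, map_sum, op_mul,
    LinearMap.sum_apply]
  exact Finset.sum_comm

theorem isEquivariant_opMat (x : Matrix ι κ (invMat θ)) :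
    IsEquivariant (F.pow ι) (F.pow κ) (B.opMat x) := fun g v => funext fun c => by
  refine (B.opMat_apply x _ c).trans ?_
  refine Eq.trans ?_ (congrArg (F.act g) (B.opMat_apply x v c).symm)
  rw [map_sum]
  exact Finset.sum_congr rfl fun a _ => B.isEquivariant_op _ g _

/-- Inclusions and projections of the summands are equivariant, so every block of `f` is an
equivariant endomorphism of `F`. -/
theorem exists_opMat [DecidableEq ι] {f : (ι → F.carrier) →ₗ[R] (κ → F.carrier)}
    (hf : IsEquivariant (F.pow ι) (F.pow κ) f) : ∃ x, B.opMat x = f := by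
  have h : ∀ a c, IsEquivariant F F
      (LinearMap.proj c ∘ₗ f ∘ₗ LinearMap.single R (fun _ : ι => F.carrier) a) := by
    intro a c g v
    have h1 : (Pi.single a (F.act g v) : ι → F.carrier)
        = (F.pow ι).act g (Pi.single a v : ι → F.carrier) := by
      funext a'
      change _ = F.act g _
      by_cases h : a' = a
      · subst h; simp
      · simp [h]
    change f (Pi.single a (F.act g v)) c = F.act g (f (Pi.single a v) c)
    rw [h1]
    exact congrFun (hf g (Pi.single a v : ι → F.carrier)) c
  choose x hx using fun a c => B.exists_op (h a c)
  refine ⟨.of x, LinearMap.ext fun v => funext fun c => ?_⟩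
  rw [opMat_apply]
  have h2 : v = ∑ a, (Pi.single a (v a) : ι → F.carrier) := (Finset.univ_sum_single v).symm
  conv_rhs => rw [h2]
  rw [map_sum, Finset.sum_apply]
  exact Finset.sum_congr rfl fun a _ => by rw [Matrix.of_apply, hx]; rfl

omit [Fintype κ] in
theorem opMat_injective [DecidableEq ι] :
    Function.Injective (B.opMat : Matrix ι κ (invMat θ) → _) := fun x y h => by
  refine Matrix.ext fun a c => B.op_injective (LinearMap.ext fun v => ?_)
  have h1 := congrFun (LinearMap.congr_fun h (Pi.single a v)) c
  rw [opMat_apply, opMat_apply, Finset.sum_eq_single a, Finset.sum_eq_single a] at h1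
  · simpa using h1
  all_goals simp +contextual

/-- The equivariant module `E` is the image of the operator on `F^ι` defined by `e`. -/
def Represents (E : EquivModule.{u} θ) (e : Matrix ι ι (invMat θ)) : Prop :=
  ∃ (i : E.carrier →ₗ[R] (ι → F.carrier)) (p : (ι → F.carrier) →ₗ[R] E.carrier),
    IsEquivariant E (F.pow ι) i ∧ IsEquivariant (F.pow ι) E p ∧ p ∘ₗ i = LinearMap.id ∧
      i ∘ₗ p = B.opMat e

variable {B}

theorem Represents.idem [DecidableEq ι] {E : EquivModule.{u} θ} {e : Matrix ι ι (invMat θ)}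
    (h : B.Represents E e) : e * e = e := by
  obtain ⟨i, p, -, -, h1, h2⟩ := h
  refine B.opMat_injective ?_
  rw [opMat_mul, ← h2, LinearMap.comp_assoc, ← LinearMap.comp_assoc p i p, h1, LinearMap.id_comp]

/-- For a normalised pair, `x` and `y` restrict to mutually inverse equivariant maps between the
images of the two idempotents. -/
theorem Represents.iso [DecidableEq ι] [DecidableEq κ] {E E' : EquivModule.{u} θ}
    {e : Matrix ι ι (invMat θ)} {e' : Matrix κ κ (invMat θ)} (h : B.Represents E e)
    (h' : B.Represents E' e') (hee' : MvEquiv e e') : E.Iso E' := by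
  obtain ⟨x, y, hxy, hyx, -, hxe, -, hye⟩ := hee'.exists_normal h.idem h'.idem
  obtain ⟨i, p, hi, hp, h1, h2⟩ := h
  obtain ⟨i', p', hi', hp', h1', h2'⟩ := h'
  refine ⟨LinearEquiv.ofLinearMap (p' ∘ₗ B.opMat x ∘ₗ i) (p ∘ₗ B.opMat y ∘ₗ i') ?_ ?_, ?_⟩
  · calc (p' ∘ₗ B.opMat x ∘ₗ i) ∘ₗ p ∘ₗ B.opMat y ∘ₗ i'
        = p' ∘ₗ (B.opMat x ∘ₗ (i ∘ₗ p) ∘ₗ B.opMat y) ∘ₗ i' := rfl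
      _ = p' ∘ₗ (i' ∘ₗ p') ∘ₗ i' := by
        rw [h2, ← opMat_mul, ← opMat_mul, hye, hyx, h2']
      _ = (p' ∘ₗ i') ∘ₗ (p' ∘ₗ i') := rfl
      _ = LinearMap.id := by rw [h1', LinearMap.id_comp]
  · calc (p ∘ₗ B.opMat y ∘ₗ i') ∘ₗ p' ∘ₗ B.opMat x ∘ₗ i
        = p ∘ₗ (B.opMat y ∘ₗ (i' ∘ₗ p') ∘ₗ B.opMat x) ∘ₗ i := rfl
      _ = p ∘ₗ (i ∘ₗ p) ∘ₗ i := by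
        rw [h2', ← opMat_mul, ← opMat_mul, hxe, hxy, h2]
      _ = (p ∘ₗ i) ∘ₗ (p ∘ₗ i) := rfl
      _ = LinearMap.id := by rw [h1, LinearMap.id_comp]
  · exact hp'.comp ((B.isEquivariant_opMat x).comp hi)

/-- An isomorphism `f` extends to the ambient powers as `i' f p`, and its inverse as `i f⁻¹ p'`; the
matrices of these two maps give the equivalence. With `E = E'` this also shows that the class of a
representing idempotent is independent of the choices. -/
theorem Represents.mvEquiv [DecidableEq ι] [DecidableEq κ] {E E' : EquivModule.{u} θ}
    {e : Matrix ι ι (invMat θ)} {e' : Matrix κ κ (invMat θ)} (h : B.Represents E e)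
    (h' : B.Represents E' e') (hEE' : E.Iso E') : MvEquiv e e' := by
  obtain ⟨i, p, hi, hp, h1, h2⟩ := h
  obtain ⟨i', p', hi', hp', h1', h2'⟩ := h'
  obtain ⟨f, hf⟩ := hEE'
  have hf1 : IsEquivariant E E' f.toLinearMap := hf
  have hf2 : IsEquivariant E' E f.symm.toLinearMap := fun g e => by
    change f.symm _ = E.act g (f.symm e)
    rw [LinearEquiv.symm_apply_eq, hf, LinearEquiv.apply_symm_apply]
  obtain ⟨x, hx⟩ := B.exists_opMat (hi'.comp (hf1.comp hp))
  obtain ⟨y, hy⟩ := B.exists_opMat (hi.comp (hf2.comp hp'))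
  refine ⟨x, y, B.opMat_injective ?_, B.opMat_injective ?_⟩
  · rw [opMat_mul, hx, hy]
    calc (i ∘ₗ f.symm.toLinearMap ∘ₗ p') ∘ₗ i' ∘ₗ f.toLinearMap ∘ₗ p
        = i ∘ₗ f.symm.toLinearMap ∘ₗ (p' ∘ₗ i') ∘ₗ f.toLinearMap ∘ₗ p := rfl
      _ = i ∘ₗ (f.symm.toLinearMap ∘ₗ f.toLinearMap) ∘ₗ p := by
        rw [h1', LinearMap.id_comp, LinearMap.comp_assoc]
      _ = B.opMat e := by
        rw [LinearEquiv.symm_comp, LinearMap.id_comp, h2]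
  · rw [opMat_mul, hx, hy]
    calc (i' ∘ₗ f.toLinearMap ∘ₗ p) ∘ₗ i ∘ₗ f.symm.toLinearMap ∘ₗ p'
        = i' ∘ₗ f.toLinearMap ∘ₗ (p ∘ₗ i) ∘ₗ f.symm.toLinearMap ∘ₗ p' := rfl
      _ = i' ∘ₗ (f.toLinearMap ∘ₗ f.symm.toLinearMap) ∘ₗ p' := by
        rw [h1, LinearMap.id_comp, LinearMap.comp_assoc]
      _ = B.opMat e' := by
        rw [LinearEquiv.comp_symm, LinearMap.id_comp, h2']

theorem Represents.sum {E E' : EquivModule.{u} θ}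
    {e : Matrix ι ι (invMat θ)} {e' : Matrix κ κ (invMat θ)} (h : B.Represents E e)
    (h' : B.Represents E' e') : B.Represents (E.sum E') (fromBlocks e 0 0 e') := by
  obtain ⟨i, p, hi, hp, h1, h2⟩ := h
  obtain ⟨i', p', hi', hp', h1', h2'⟩ := h'
  let I : E.carrier × E'.carrier →ₗ[R] (ι ⊕ κ → F.carrier) :=
    LinearMap.pi (Sum.elim (fun a => LinearMap.proj a ∘ₗ i ∘ₗ LinearMap.fst R _ _)
      (fun c => LinearMap.proj c ∘ₗ i' ∘ₗ LinearMap.snd R _ _))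
  let P : (ι ⊕ κ → F.carrier) →ₗ[R] E.carrier × E'.carrier :=
    LinearMap.prod (p ∘ₗ LinearMap.funLeft R F.carrier Sum.inl)
      (p' ∘ₗ LinearMap.funLeft R F.carrier Sum.inr)
  have hI : ∀ v, I v = Sum.elim (i v.1) (i' v.2) := fun v => by
    funext a; rcases a with a | a <;> rfl
  refine ⟨I, P, ?_, ?_, ?_, ?_⟩
  · rintro g ⟨e, e'⟩
    funext a
    rcases a with a | a
    · exact congrFun (hi g e) a
    · exact congrFun (hi' g e') a
  · intro g v
    exact Prod.ext (hp g fun a => v (Sum.inl a)) (hp' g fun a => v (Sum.inr a))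
  · refine LinearMap.ext fun v => Prod.ext ?_ ?_
    · exact LinearMap.congr_fun h1 v.1
    · exact LinearMap.congr_fun h1' v.2
  · refine LinearMap.ext fun v => funext fun a => ?_
    rw [opMat_apply, Fintype.sum_sum_type]
    rcases a with a | a
    · simp only [fromBlocks_apply₁₁, fromBlocks_apply₂₁, Matrix.zero_apply, map_zero,
        LinearMap.zero_apply, Finset.sum_const_zero, add_zero]
      rw [← opMat_apply B e fun a => v (Sum.inl a), ← h2]
      rfl
    · simp only [fromBlocks_apply₁₂, fromBlocks_apply₂₂, Matrix.zero_apply, map_zero,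
        LinearMap.zero_apply, Finset.sum_const_zero, zero_add]
      rw [← opMat_apply B e' fun a => v (Sum.inr a), ← h2']
      rfl

variable (B)

theorem exists_represents_of_idem {e : Matrix ι ι (invMat θ)} (he : e * e = e) :
    ∃ E : EquivModule.{u} θ, B.Represents E e := by
  have hpp : B.opMat e ∘ₗ B.opMat e = B.opMat e := by rw [← opMat_mul, he]
  refine ⟨(F.pow ι).ofRetract (B.opMat e) (B.isEquivariant_opMat e) hpp,
    (LinearMap.range (B.opMat e)).subtype, (B.opMat e).rangeRestrict, fun g x => rfl,
    fun g x => Subtype.ext (B.isEquivariant_opMat e g x), ?_, rfl⟩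
  refine LinearMap.ext ?_
  rintro ⟨_, x, rfl⟩
  exact Subtype.ext (LinearMap.congr_fun hpp x)

/-- Each generator of `E` extends to an equivariant map from the regular module. Together they give
an equivariant surjection `F^n → E`, which splits linearly because `E` is projective, then
equivariantly by averaging. -/
theorem exists_represents (E : EquivModule.{u} θ) :
    ∃ e : IdemMat (invMat θ), B.Represents E e.e := by
  obtain ⟨n, f, hf⟩ := Module.Finite.exists_fin' R E.carrier
  let p : (Fin n → F.carrier) →ₗ[R] E.carrier :=
    ∑ a, B.lift E (f (Pi.single a 1)) ∘ₗ LinearMap.proj a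
  have hpv : ∀ v, p v = ∑ a, B.lift E (f (Pi.single a 1)) (v a) := fun v => by simp [p]
  have hp : IsEquivariant (F.pow (Fin n)) E p := fun g v => by
    refine (hpv _).trans (Eq.trans ?_ (congrArg (E.act g) (hpv v).symm))
    rw [map_sum]
    exact Finset.sum_congr rfl fun a _ => B.isEquivariant_lift _ _ g _
  have hsurj : Function.Surjective p := fun e => by
    obtain ⟨c, rfl⟩ := hf e
    -- The basis vectors at the neutral element already map to the generators.
    refine ⟨fun a => c a • B.b 1, ?_⟩
    rw [hpv]
    conv_rhs => rw [← Finset.univ_sum_single c]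
    rw [map_sum]
    refine Finset.sum_congr rfl fun a _ => ?_
    rw [map_smul, lift_b, E.act_one, ← map_smul, ← Pi.single_smul, smul_eq_mul, mul_one]
  obtain ⟨s, hs⟩ := Module.projective_lifting_property p LinearMap.id hsurj
  obtain ⟨i, hi, hpi⟩ := exists_equivariant_section hp hs
  obtain ⟨e, he⟩ := B.exists_opMat (hi.comp hp)
  have h : B.Represents E e := ⟨i, p, hi, hp, hpi, he.symm⟩
  exact ⟨⟨Fin n, e, h.idem⟩, h⟩

/-- Isomorphism classes of equivariant modules correspond to classes of idempotent matrices over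
the ring of invariant matrices. -/
def isoClassEquiv : EquivModule.IsoClass.{u} θ ≃+ IdemClass (invMat θ) :=
  AddEquiv.ofBijective (M := EquivModule.IsoClass.{u} θ) (N := IdemClass (invMat θ))
    (F := EquivModule.IsoClass.{u} θ →+ IdemClass (invMat θ))
    { toFun := Quotient.lift (fun E => IdemClass.mk (B.exists_represents E).choose) fun E E' h =>
        IdemClass.mk_eq_iff.2 ((B.exists_represents E).choose_spec.mvEquiv
          (B.exists_represents E').choose_spec h)
      map_zero' := by
        refine IdemClass.mk_eq_iff.2 ((B.exists_represents (EquivModule.zero θ)).choose_spec.mvEquiv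
          (E' := EquivModule.zero θ) ⟨0, 0, ?_, ?_, ?_, ?_⟩ (Setoid.refl (EquivModule.zero θ)))
        · intro g x; funext a; exact a.elim
        · intro g x; rfl
        · exact LinearMap.ext fun x => rfl
        · exact LinearMap.ext fun x => funext fun a => a.elim
      map_add' := by
        rintro ⟨E⟩ ⟨E'⟩
        exact IdemClass.mk_eq_iff.2 ((B.exists_represents (E.sum E')).choose_spec.mvEquiv
          ((B.exists_represents E).choose_spec.sum (B.exists_represents E').choose_spec)
          (Setoid.refl (E.sum E'))) }
    ⟨by
      rintro ⟨E⟩ ⟨E'⟩ h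
      exact Quotient.sound ((B.exists_represents E).choose_spec.iso
        (B.exists_represents E').choose_spec (IdemClass.mk_eq_iff.1 h)), by
      intro a
      obtain ⟨e, rfl⟩ := IdemClass.exists_mk a
      obtain ⟨E, hE⟩ := B.exists_represents_of_idem e.idem
      exact ⟨⟦E⟧, IdemClass.mk_eq_iff.2 ((B.exists_represents E).choose_spec.mvEquiv hE
        (Setoid.refl E))⟩⟩

/-- Allows any representing idempotent in place of the chosen one; the augmented module comes with
its own. -/
theorem isoClassEquiv_mk {E : EquivModule.{u} θ} {e : IdemMat (invMat θ)}
    (h : B.Represents E e.e) : B.isoClassEquiv ⟦E⟧ = IdemClass.mk e :=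
  IdemClass.mk_eq_iff.2 ((B.exists_represents E).choose_spec.mvEquiv h (Setoid.refl E))

end RegularBasis

end EquivariantModules

/-! ### The augmentation in terms of invariant matrices -/

section Augmentation

open Matrix

/-! ### Functoriality of Grothendieck groups -/

theorem grothendieck_lift_of {M N : Type*} [AddCommMonoid M] [AddCommGroup N] (f : M →+ N)
    (m : M) : Algebra.GrothendieckAddGroup.lift f (Algebra.GrothendieckAddGroup.of m) = f m :=
  DFunLike.congr_fun (Algebra.GrothendieckAddGroup.lift.symm_apply_apply f) m

theorem grothendieck_hom_ext {M N : Type*} [AddCommMonoid M] [AddCommGroup N]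
    {f g : Algebra.GrothendieckAddGroup M →+ N}
    (h : ∀ m, f (Algebra.GrothendieckAddGroup.of m) = g (Algebra.GrothendieckAddGroup.of m)) :
    f = g :=
  Algebra.GrothendieckAddGroup.lift.symm.injective (AddMonoidHom.ext h)

/-- The homomorphism of Grothendieck groups induced by a homomorphism of monoids. -/
def grothendieckMap {M N : Type*} [AddCommMonoid M] [AddCommMonoid N] (f : M →+ N) :
    Algebra.GrothendieckAddGroup M →+ Algebra.GrothendieckAddGroup N :=
  Algebra.GrothendieckAddGroup.lift (Algebra.GrothendieckAddGroup.of.comp f)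

theorem grothendieckMap_of {M N : Type*} [AddCommMonoid M] [AddCommMonoid N] (f : M →+ N)
    (m : M) : grothendieckMap f (Algebra.GrothendieckAddGroup.of m)
      = Algebra.GrothendieckAddGroup.of (f m) :=
  grothendieck_lift_of _ m

/-- The isomorphism of Grothendieck groups induced by an isomorphism of monoids. -/
def grothendieckCongr {M N : Type*} [AddCommMonoid M] [AddCommMonoid N] (f : M ≃+ N) :
    Algebra.GrothendieckAddGroup M ≃+ Algebra.GrothendieckAddGroup N :=
  AddMonoidHom.toAddEquiv (grothendieckMap (f : M →+ N)) (grothendieckMap (f.symm : N →+ M))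
    (grothendieck_hom_ext fun m => by
      rw [AddMonoidHom.comp_apply, grothendieckMap_of, grothendieckMap_of]
      simp)
    (grothendieck_hom_ext fun m => by
      rw [AddMonoidHom.comp_apply, grothendieckMap_of, grothendieckMap_of]
      simp)

theorem grothendieckCongr_of {M N : Type*} [AddCommMonoid M] [AddCommMonoid N] (f : M ≃+ N)
    (m : M) : grothendieckCongr f (Algebra.GrothendieckAddGroup.of m)
      = Algebra.GrothendieckAddGroup.of (f m) :=
  grothendieckMap_of _ m

/-- Isomorphic homomorphisms have isomorphic kernels. -/
theorem nonempty_ker_equiv_of_square {M N M' N' : Type*} [AddCommGroup M] [AddCommGroup N]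
    [AddCommGroup M'] [AddCommGroup N'] (φ : M →+ N) (φ' : M' →+ N') (a : M ≃+ M') (b : N ≃+ N')
    (h : ∀ x, φ' (a x) = b (φ x)) : Nonempty (φ.ker ≃+ φ'.ker) :=
  ⟨AddEquiv.ofBijective (((a : M →+ M').comp φ.ker.subtype).codRestrict φ'.ker fun x => by
      rw [AddMonoidHom.mem_ker]
      exact (h x).trans ((congrArg b x.2).trans (map_zero b)))
    ⟨fun x y hxy => Subtype.ext (a.injective (congrArg Subtype.val hxy)), fun y =>
      ⟨⟨a.symm y, by
        rw [AddMonoidHom.mem_ker, ← b.map_eq_zero_iff, ← h, a.apply_symm_apply]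
        exact y.2⟩, Subtype.ext (a.apply_symm_apply y)⟩⟩⟩

variable {G : Type} [Group G]
  {A : Type u} [NonUnitalRing A] [Module ℂ A] [IsScalarTower ℂ A A] [SMulCommClass ℂ A A]

/-- The augmentation `A⁺ → ℂ`. -/
abbrev augHom (A : Type u) [NonUnitalRing A] [Module ℂ A] [IsScalarTower ℂ A A]
    [SMulCommClass ℂ A A] : Unitization ℂ A →+* ℂ := (Unitization.fstHom ℂ A : _ →ₐ[ℂ] ℂ)

theorem augHom_unitization (α : AlgAction G A) (g : G) (r : Unitization ℂ A) :
    augHom A (α.unitization g r) = augHom A r := by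
  induction r using Unitization.ind with
  | inl_add_inr z a =>
    have h : α.unitization g (Unitization.inl z + (a : Unitization ℂ A)) = _ :=
      α.unitizationHom_apply g z a
    rw [h]
    simp

/-- The map `E / A E → F / A F` induced by a linear map, as a complex linear map. -/
def augLinear (α : AlgAction G A) {E F : EquivModule.{u} α.unitization}
    (f : E.carrier →ₗ[Unitization ℂ A] F.carrier) :
    (augModule α E).carrier →ₗ[ℂ] (augModule α F).carrier where
  toFun := augMap (A := A) f
  map_add' := map_add (augMap (A := A) f)
  map_smul' z (q : E.carrier ⧸ augSubmodule A E.carrier) :=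
    map_smul (augMap (A := A) f) (Unitization.inl z : Unitization ℂ A) q

/-- The class in `E / A E` of an element of `E`. -/
def augMk (α : AlgAction G A) (E : EquivModule.{u} α.unitization) (e : E.carrier) :
    (augModule α E).carrier :=
  (Submodule.Quotient.mk e : E.carrier ⧸ augSubmodule A E.carrier)

theorem exists_augMk (α : AlgAction G A) (E : EquivModule.{u} α.unitization)
    (q : (augModule α E).carrier) : ∃ e, augMk α E e = q :=
  Submodule.Quotient.mk_surjective _ q

theorem augLinear_mk (α : AlgAction G A) {E F : EquivModule.{u} α.unitization}
    (f : E.carrier →ₗ[Unitization ℂ A] F.carrier) (e : E.carrier) :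
    augLinear α f (augMk α E e) = augMk α F (f e) := rfl

theorem act_augMk (α : AlgAction G A) (E : EquivModule.{u} α.unitization) (g : G)
    (e : E.carrier) : (augModule α E).act g (augMk α E e) = augMk α E (E.act g e) := rfl

theorem isEquivariant_augLinear (α : AlgAction G A) {E F : EquivModule.{u} α.unitization}
    {f : E.carrier →ₗ[Unitization ℂ A] F.carrier} (hf : IsEquivariant E F f) :
    IsEquivariant (augModule α E) (augModule α F) (augLinear α f) := fun g q => by
  obtain ⟨e, rfl⟩ := exists_augMk α E q
  rw [act_augMk, augLinear_mk, augLinear_mk, act_augMk, hf]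

variable [Fintype G] [DecidableEq G]

/-- The augmentation of invariant matrices. -/
def invMatAug (α : AlgAction G A) :
    invMat α.unitization →+* invMat (1 : G →* (ℂ →ₐ[ℂ] ℂ)) :=
  ((augHom A).mapMatrix.comp (invMat α.unitization).subtype).codRestrict _ fun a g h k => by
    refine (congrArg (augHom A) (a.2 g h k)).trans ?_
    rw [augHom_unitization]
    rfl

theorem invMatAug_apply (α : AlgAction G A) (a : invMat α.unitization) (h k : G) :
    (invMatAug α a).1 h k = augHom A (a.1 h k) := rfl

/-- Scalar invariant matrices. -/
def invMatScalar (α : AlgAction G A) :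
    invMat (1 : G →* (ℂ →ₐ[ℂ] ℂ)) →+* invMat α.unitization :=
  ((algebraMap ℂ (Unitization ℂ A)).mapMatrix.comp (invMat _).subtype).codRestrict _
    fun a g h k => by
      refine (congrArg (algebraMap ℂ (Unitization ℂ A)) (a.2 g h k)).trans ?_
      exact ((α.unitization g).commutes _).symm

theorem invMatScalar_apply (α : AlgAction G A) (a : invMat (1 : G →* (ℂ →ₐ[ℂ] ℂ))) (h k : G) :
    (invMatScalar α a).1 h k = algebraMap ℂ (Unitization ℂ A) (a.1 h k) := rfl

theorem invMatAug_scalar (α : AlgAction G A) (a : invMat (1 : G →* (ℂ →ₐ[ℂ] ℂ))) :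
    invMatAug α (invMatScalar α a) = a := by
  refine Subtype.ext (Matrix.ext fun h k => ?_)
  rw [invMatAug_apply, invMatScalar_apply]
  exact (Unitization.fstHom ℂ A).commutes _

/-! ### Reduction of regular modules modulo the augmentation ideal -/

section RegularAug

variable {α : AlgAction G A} {F : EquivModule.{u} α.unitization} (B : RegularBasis F)
  {F₀ : EquivModule.{u} (1 : G →* (ℂ →ₐ[ℂ] ℂ))} (B₀ : RegularBasis F₀)

/-- The map of regular modules given by the augmentation of the coordinates. -/
def regularAug : F.carrier →ₛₗ[augHom A] F₀.carrier where
  toFun v := ∑ h, augHom A (B.b.repr v h) • B₀.b h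
  map_add' v w := by simp [add_smul, Finset.sum_add_distrib]
  map_smul' r v := by simp [Finset.smul_sum, smul_smul]

omit [DecidableEq G] in
theorem regularAug_b (h : G) : regularAug B B₀ (B.b h) = B₀.b h := by
  change ∑ k, augHom A (B.b.repr (B.b h) k) • B₀.b k = _
  rw [Finset.sum_eq_single h] <;> simp +contextual [eq_comm]

omit [DecidableEq G] in
theorem regularAug_sum (c : G → Unitization ℂ A) :
    regularAug B B₀ (∑ h, c h • B.b h) = ∑ h, augHom A (c h) • B₀.b h := by
  rw [map_sum]
  exact Finset.sum_congr rfl fun h _ => by rw [map_smulₛₗ, regularAug_b]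

omit [DecidableEq G] in
theorem regularAug_act (g : G) (v : F.carrier) :
    regularAug B B₀ (F.act g v) = F₀.act g (regularAug B B₀ v) := by
  conv_lhs => rw [← B.b.sum_repr v]
  conv_rhs => rw [← B.b.sum_repr v]
  rw [regularAug_sum]
  simp only [map_sum, F.act_smul, F₀.act_smul, B.act_b, B₀.act_b, map_smulₛₗ, regularAug_b,
    augHom_unitization]
  rfl

theorem regularAug_op (x : invMat α.unitization) (v : F.carrier) :
    regularAug B B₀ (B.op x v) = B₀.op (invMatAug α x) (regularAug B B₀ v) := by
  rw [← B.b.sum_repr v, regularAug_sum]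
  simp only [map_sum, map_smul, map_smulₛₗ, RegularBasis.op_b, regularAug_b]
  rfl

variable (ι : Type) [Fintype ι]

/-- The isomorphism of `F^ι / A F^ι` with the corresponding module over `ℂ`. -/
def augPowEquiv : (augModule α (F.pow ι)).carrier ≃ₗ[ℂ] (F₀.pow ι).carrier where
  toFun := Submodule.liftQ (augSubmodule A (F.pow ι).carrier)
    ({ toFun := fun (v : ι → F.carrier) a => regularAug B B₀ (v a)
       map_add' := fun v w => funext fun a => map_add _ _ _
       map_smul' := fun r v => funext fun a => map_smulₛₗ (regularAug B B₀) r (v a) } :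
      (F.pow ι).carrier →ₛₗ[augHom A] (F₀.pow ι).carrier) (by
      refine Submodule.span_le.2 ?_
      rintro _ ⟨x, v, rfl⟩
      refine funext fun a => ?_
      refine (map_smulₛₗ (regularAug B B₀) (x : Unitization ℂ A) _).trans ?_
      simp
      rfl)
  map_add' q q' := map_add _ q q'
  map_smul' z q := map_smulₛₗ (Submodule.liftQ (augSubmodule A (F.pow ι).carrier) _ _)
    (Unitization.inl z : Unitization ℂ A) q
  invFun w := augMk α (F.pow ι) fun a =>
    ∑ h, (Unitization.inl (B₀.b.repr (w a) h) : Unitization ℂ A) • B.b h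
  left_inv q := by
    obtain ⟨v, rfl⟩ := exists_augMk α _ q
    change ι → F.carrier at v
    refine (Submodule.Quotient.eq _).2 ?_
    classical
    -- Replacing every coordinate of `v` by its scalar part changes `v` by a combination of basis
    -- vectors with coefficients in `A`, that is by an element of `A F^ι`.
    have h : (fun a => ∑ h, (Unitization.inl (B₀.b.repr (regularAug B B₀ (v a)) h) :
          Unitization ℂ A) • B.b h) - v
        = ∑ a, ∑ h, ((-(B.b.repr (v a) h).snd : A) : Unitization ℂ A) •
            (Pi.single a (B.b h) : ι → F.carrier) := by
      funext a
      have h1 : ∀ h, B₀.b.repr (regularAug B B₀ (v a)) h = (B.b.repr (v a) h).fst := fun h =>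
        congrFun (B₀.b.repr_sum_self _) h
      rw [Pi.sub_apply]
      conv_lhs => enter [2]; rw [← B.b.sum_repr (v a)]
      simp only [h1]
      rw [← Finset.sum_sub_distrib, Finset.sum_apply, Finset.sum_eq_single a]
      · rw [Finset.sum_apply]
        refine Finset.sum_congr rfl fun h _ => ?_
        rw [Pi.smul_apply, Pi.single_eq_same, ← sub_smul]
        congr 1
        rw [Unitization.inr_neg, sub_eq_iff_eq_add, eq_neg_add_iff_add_eq, add_comm]
        exact Unitization.inl_fst_add_inr_snd_eq _
      · intro b _ hb
        rw [Finset.sum_apply]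
        refine Finset.sum_eq_zero fun h _ => ?_
        rw [Pi.smul_apply, Pi.single_eq_of_ne (Ne.symm hb), smul_zero]
      · simp
    refine (congrArg (· ∈ augSubmodule A (ι → F.carrier)) h).mpr ?_
    exact Submodule.sum_mem _ fun a _ => Submodule.sum_mem _ fun h _ =>
      Submodule.subset_span ⟨_, _, rfl⟩
  right_inv w := by
    funext a
    refine (regularAug_sum B B₀ _).trans ?_
    simp

omit [DecidableEq G] in
theorem isEquivariant_augPowEquiv : IsEquivariant (augModule α (F.pow ι)) (F₀.pow ι)
    (augPowEquiv B B₀ ι).toLinearMap := fun g q => by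
  obtain ⟨v, rfl⟩ := exists_augMk α _ q
  exact funext fun a => regularAug_act B B₀ g (v a)

omit [Fintype G] [DecidableEq G] in
theorem isEquivariant_symm {R : Type v} [Ring R] [Algebra ℂ R] {θ : G →* (R →ₐ[ℂ] R)}
    {E F : EquivModule.{u} θ} {f : E.carrier ≃ₗ[R] F.carrier}
    (h : IsEquivariant E F f.toLinearMap) : IsEquivariant F E f.symm.toLinearMap := fun g e => by
  change f.symm _ = E.act g (f.symm e)
  rw [LinearEquiv.symm_apply_eq]
  refine Eq.trans ?_ (h g _).symm
  exact congrArg (F.act g) (f.apply_symm_apply e).symm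

variable {ι}

theorem augPowEquiv_opMat (e : Matrix ι ι (invMat α.unitization)) :
    (augPowEquiv B B₀ ι).toLinearMap ∘ₗ augLinear α (E := F.pow ι) (F := F.pow ι) (B.opMat e)
      = B₀.opMat (e.map (invMatAug α)) ∘ₗ (augPowEquiv B B₀ ι).toLinearMap := by
  refine LinearMap.ext fun q => ?_
  obtain ⟨v, rfl⟩ := exists_augMk α _ q
  refine funext fun c => ?_
  refine Eq.trans ?_ (B₀.opMat_apply (e.map (invMatAug α)) _ c).symm
  refine (congrArg (regularAug B B₀) (B.opMat_apply e v c)).trans ?_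
  rw [map_sum]
  exact Finset.sum_congr rfl fun a _ => regularAug_op B B₀ _ _

omit [Fintype G] [DecidableEq G] in
theorem augLinear_comp {E F K : EquivModule.{u} α.unitization}
    (f : F.carrier →ₗ[Unitization ℂ A] K.carrier) (f' : E.carrier →ₗ[Unitization ℂ A] F.carrier) :
    augLinear α f ∘ₗ augLinear α f' = augLinear α (E := E) (F := K) (f ∘ₗ f') := by
  refine LinearMap.ext fun q => ?_
  obtain ⟨e, rfl⟩ := exists_augMk α _ q
  rfl

omit [Fintype G] [DecidableEq G] in
theorem augLinear_id {E : EquivModule.{u} α.unitization} :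
    augLinear α (E := E) (F := E) LinearMap.id = LinearMap.id := by
  refine LinearMap.ext fun q => ?_
  obtain ⟨e, rfl⟩ := exists_augMk α _ q
  rfl

/-- The functor `E ↦ E / A E` preserves retractions, and on `F^ι` it is the power `F₀^ι`, where an
operator turns into its entrywise augmentation. -/
theorem RegularBasis.Represents.aug {E : EquivModule.{u} α.unitization}
    {e : Matrix ι ι (invMat α.unitization)} (h : B.Represents E e) :
    B₀.Represents (augModule α E) (e.map (invMatAug α)) := by
  obtain ⟨i, p, hi, hp, h1, h2⟩ := h
  have hU := isEquivariant_augPowEquiv B B₀ ι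
  refine ⟨(augPowEquiv B B₀ ι).toLinearMap ∘ₗ augLinear α (F := F.pow ι) i,
    augLinear α (E := F.pow ι) p ∘ₗ (augPowEquiv B B₀ ι).symm.toLinearMap,
    hU.comp (isEquivariant_augLinear α hi),
    (isEquivariant_augLinear α hp).comp (isEquivariant_symm hU), ?_, ?_⟩
  · calc _ = augLinear α (E := F.pow ι) p ∘ₗ ((augPowEquiv B B₀ ι).symm.toLinearMap ∘ₗ
          (augPowEquiv B B₀ ι).toLinearMap) ∘ₗ augLinear α (F := F.pow ι) i := rfl
      _ = augLinear α (E := E) (F := E) (p ∘ₗ i) := by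
        rw [LinearEquiv.symm_comp, LinearMap.id_comp]
        exact augLinear_comp (F := F.pow ι) p i
      _ = LinearMap.id := by
        rw [h1]
        exact augLinear_id
  · have h3 : augLinear α (F := F.pow ι) i ∘ₗ augLinear α (E := F.pow ι) p
        = augLinear α (E := F.pow ι) (F := F.pow ι) (B.opMat e) :=
      (augLinear_comp (E := F.pow ι) (K := F.pow ι) i p).trans (congrArg _ h2)
    have h4 := augPowEquiv_opMat B B₀ e
    rw [← h3] at h4
    exact LinearMap.ext fun w =>
      (LinearMap.congr_fun h4 ((augPowEquiv B B₀ ι).symm w)).trans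
        (congrArg (B₀.opMat _) ((augPowEquiv B B₀ ι).apply_symm_apply w))

end RegularAug

/-- The equivariant `K`-group of `A` in terms of the ring of invariant matrices over `A⁺`. -/
theorem nonempty_equivariantK_equiv (α : AlgAction G A) :
    Nonempty (EquivariantK α ≃+ (KZero.map (invMatAug α)).ker) := by
  let B : RegularBasis (regularModule.{u} α.unitization) := regularBasis _
  let B₀ : RegularBasis (regularModule.{u} (1 : G →* (ℂ →ₐ[ℂ] ℂ))) := regularBasis _
  refine nonempty_ker_equiv_of_square _ _ (grothendieckCongr B.isoClassEquiv)
    (grothendieckCongr B₀.isoClassEquiv) fun x => ?_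
  -- Both sides are additive, so it is enough to compare them on the class of a module; if `e`
  -- represents it, both give the class of the augmented matrix of `e`.
  have h : (KZero.map (invMatAug α)).comp (grothendieckCongr B.isoClassEquiv).toAddMonoidHom
      = (grothendieckCongr B₀.isoClassEquiv).toAddMonoidHom.comp (augmentation α) := by
    refine grothendieck_hom_ext ?_
    intro a
    obtain ⟨E, rfl⟩ := Quotient.exists_rep (s := EquivModule.setoid α.unitization) a
    obtain ⟨e, he⟩ := B.exists_represents E
    have h1 := B.isoClassEquiv_mk he
    have h2 := B₀.isoClassEquiv_mk (e := e.map (invMatAug α)) (he.aug B B₀)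
    refine (congrArg (KZero.map (invMatAug α)) ((grothendieckCongr_of _ _).trans
      (congrArg Algebra.GrothendieckAddGroup.of h1))).trans ?_
    refine (grothendieck_lift_of _ _).trans (Eq.trans ?_ (congrArg
      (grothendieckCongr B₀.isoClassEquiv) (grothendieck_lift_of _ _).symm))
    exact ((grothendieckCongr_of _ _).trans (congrArg Algebra.GrothendieckAddGroup.of h2)).symm
  exact DFunLike.congr_fun h x

end Augmentation

/-! ### Actions by inner automorphisms of the multiplier algebra -/

section Inner

open Matrix

/-- Left and right multiplication on `A` by a group of invertible multipliers that implements the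
action `α`. -/
structure MultiplierImplementation {G : Type} [Group G] {A : Type u} [NonUnitalRing A] [Module ℂ A]
    (α : AlgAction G A) where
  left : G → A →ₗ[ℂ] A
  right : G → A →ₗ[ℂ] A
  left_one : ∀ a, left 1 a = a
  right_one : ∀ a, right 1 a = a
  left_mul : ∀ g h a, left (g * h) a = left g (left h a)
  right_mul : ∀ g h a, right (g * h) a = right h (right g a)
  left_right : ∀ g h a, left g (right h a) = right h (left g a)
  left_apply_mul : ∀ g a b, left g (a * b) = left g a * b
  right_apply_mul : ∀ g a b, right g (a * b) = a * right g b
  right_mul_eq : ∀ g a b, right g a * b = a * left g b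
  act_eq : ∀ g a, α.act g a = left g (right g⁻¹ a)

/-- The trivial action is implemented by the identity. -/
def MultiplierImplementation.trivial (G : Type) [Group G] (A : Type u) [NonUnitalRing A]
    [Module ℂ A] : MultiplierImplementation (AlgAction.trivial G A) where
  left _ := LinearMap.id
  right _ := LinearMap.id
  left_one _ := rfl
  right_one _ := rfl
  left_mul _ _ _ := rfl
  right_mul _ _ _ := rfl
  left_right _ _ _ := rfl
  left_apply_mul _ _ _ := rfl
  right_apply_mul _ _ _ := rfl
  right_mul_eq _ _ _ := rfl
  act_eq _ _ := rfl

variable (G : Type) [Group G] [Fintype G] [DecidableEq G]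
  (A : Type u) [NonUnitalRing A] [Module ℂ A] [IsScalarTower ℂ A A] [SMulCommClass ℂ A A]

/-- The algebra of `G × G` matrices over `A` that are invariant under translation; it is isomorphic
to the group algebra of `G` with coefficients in `A`. -/
def transMat : NonUnitalSubalgebra ℂ (Matrix G G A) where
  carrier := {b | ∀ g h k, b (g * h) (g * k) = b h k}
  mul_mem' {a b} ha hb g h k := by
    rw [Matrix.mul_apply, Matrix.mul_apply, ← Equiv.sum_comp (Equiv.mulLeft g)]
    exact Finset.sum_congr rfl fun l _ => by rw [← ha g h l, ← hb g l k]; rfl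
  add_mem' {a b} ha hb g h k := by
    rw [Matrix.add_apply, ha, hb, Matrix.add_apply]
  zero_mem' g h k := rfl
  smul_mem' c b hb g h k := by
    rw [Matrix.smul_apply, hb, Matrix.smul_apply]

variable {G A} {α : AlgAction G A} (m : MultiplierImplementation α)

namespace MultiplierImplementation

omit [Fintype G] [DecidableEq G] [IsScalarTower ℂ A A] [SMulCommClass ℂ A A] in
theorem left_inv_left (g : G) (a : A) : m.left g⁻¹ (m.left g a) = a := by
  rw [← m.left_mul, inv_mul_cancel, m.left_one]

omit [Fintype G] [DecidableEq G] [IsScalarTower ℂ A A] [SMulCommClass ℂ A A] in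
theorem left_left_inv (g : G) (a : A) : m.left g (m.left g⁻¹ a) = a := by
  rw [← m.left_mul, mul_inv_cancel, m.left_one]

omit [Fintype G] [DecidableEq G] [IsScalarTower ℂ A A] [SMulCommClass ℂ A A] in
theorem right_right_inv (g : G) (a : A) : m.right g (m.right g⁻¹ a) = a := by
  rw [← m.right_mul, inv_mul_cancel, m.right_one]

omit [Fintype G] [DecidableEq G] [IsScalarTower ℂ A A] [SMulCommClass ℂ A A] in
theorem right_inv_right (g : G) (a : A) : m.right g⁻¹ (m.right g a) = a := by
  rw [← m.right_mul, mul_inv_cancel, m.right_one]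

/-- Conjugation of a matrix by the diagonal matrix of the implementing multipliers. -/
def twist : transMat G A →ₙₐ[ℂ] Matrix G G (Unitization ℂ A) where
  toFun b := Matrix.of fun h k => ((m.left h (m.right k⁻¹ (b.1 h k)) : A) : Unitization ℂ A)
  map_smul' c b := by
    ext h k
    · simp
    · simp
  map_zero' := by
    ext h k
    · simp
    · simp
  map_add' b b' := by
    ext h k
    · simp
    · simp
  map_mul' b b' := by
    refine Matrix.ext fun h k => ?_
    rw [Matrix.mul_apply]
    simp only [Matrix.of_apply, ← Unitization.inr_mul]
    have h1 : ((b * b' : transMat G A).1 h k) = ∑ l, b.1 h l * b'.1 l k := rfl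
    rw [h1, map_sum, map_sum]
    refine (map_sum (Unitization.inrNonUnitalAlgHom ℂ A) _ _).trans (Finset.sum_congr rfl fun l _ => ?_)
    refine congrArg (Unitization.inr : A → Unitization ℂ A) ?_
    -- The inner factors `ρ(l)⁻¹` and `ρ(l)` meet in the middle of each summand and cancel.
    rw [m.right_apply_mul, m.left_apply_mul, m.left_right h l⁻¹, m.right_mul_eq, m.left_inv_left]

theorem lift_twist_apply (c : Unitization ℂ (transMat G A)) (h k : G) :
    Unitization.lift m.twist c h k = Unitization.inl (if h = k then c.fst else 0)
      + ((m.left h (m.right k⁻¹ (c.snd.1 h k)) : A) : Unitization ℂ A) := by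
  change (algebraMap ℂ (Matrix G G (Unitization ℂ A)) c.fst + m.twist c.snd) h k = _
  rw [Matrix.add_apply, Matrix.algebraMap_matrix_apply]
  congr 1
  split_ifs <;> simp [Unitization.algebraMap_eq_inl]

/-- The image of the algebra of translation invariant matrices, with a unit added, in the ring of
invariant matrices over `A⁺`. -/
def toInvMat : Unitization ℂ (transMat G A) →+* invMat α.unitization :=
  RingHom.codRestrict ((Unitization.lift m.twist : Unitization ℂ (transMat G A) →ₐ[ℂ]
    Matrix G G (Unitization ℂ A)) : Unitization ℂ (transMat G A) →+* _) _ fun c g h k => by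
    refine (m.lift_twist_apply c _ _).trans ?_
    refine Eq.trans ?_ (congrArg (α.unitization g) (m.lift_twist_apply c h k)).symm
    refine Eq.trans ?_ (α.unitizationHom_apply g _ _).symm
    -- Translation invariance of `b` becomes `θ`-invariance: `ρ(gh) b(gh, gk) ρ(gk)⁻¹` is the
    -- conjugate by `ρ(g)` of `ρ(h) b(h, k) ρ(k)⁻¹`.
    rw [m.act_eq, m.left_right h k⁻¹, ← m.right_mul, ← m.left_right, ← m.left_mul,
      ← _root_.mul_inv_rev, c.snd.2 g h k]
    simp only [mul_right_inj]

theorem toInvMat_apply (c : Unitization ℂ (transMat G A)) (h k : G) :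
    (m.toInvMat c).1 h k = Unitization.inl (if h = k then c.fst else 0)
      + ((m.left h (m.right k⁻¹ (c.snd.1 h k)) : A) : Unitization ℂ A) :=
  m.lift_twist_apply c h k

omit [Fintype G] [DecidableEq G] in
theorem snd_unitization (g : G) (x : Unitization ℂ A) :
    (α.unitization g x).snd = α.act g x.snd := by
  rw [← Unitization.inl_fst_add_inr_snd_eq x]
  refine (congrArg (fun y : Unitization ℂ A => y.snd) (α.unitizationHom_apply g _ _)).trans ?_
  simp

/-- The excision data that relate the invariant matrices over `A⁺` to an algebra which does not
depend on the action. -/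
def excisionData : ExcisionData (Unitization ℂ (transMat G A)) ℂ (invMat α.unitization)
    (invMat (1 : G →* (ℂ →ₐ[ℂ] ℂ))) where
  ε := augHom (transMat G A)
  η := algebraMap ℂ _
  π := invMatAug α
  s := invMatScalar α
  j := m.toInvMat
  q := (algebraMap ℂ (Matrix G G ℂ)).codRestrict _ fun z g h k => by
    simp [Matrix.algebraMap_matrix_apply]
  π_s := invMatAug_scalar α
  ε_η z := by simp
  π_j c := by
    refine Subtype.ext (Matrix.ext fun h k => ?_)
    rw [invMatAug_apply, toInvMat_apply]
    refine Eq.trans ?_ (Matrix.algebraMap_matrix_apply (r := c.fst)).symm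
    simp
  j_η z := by
    refine Subtype.ext (Matrix.ext fun h k => ?_)
    rw [invMatScalar_apply, toInvMat_apply]
    refine Eq.trans ?_ (congrArg (algebraMap ℂ (Unitization ℂ A))
      (Matrix.algebraMap_matrix_apply (r := z)).symm)
    simp [Unitization.algebraMap_eq_inl]
  j_injective := by
    rw [injective_iff_map_eq_zero]
    intro c hc
    have h1 : ∀ h k, Unitization.inl (if h = k then c.fst else 0)
        + ((m.left h (m.right k⁻¹ (c.snd.1 h k)) : A) : Unitization ℂ A) = 0 := fun h k => by
      rw [← toInvMat_apply, hc]
      rfl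
    refine Unitization.ext ?_ (Subtype.ext (Matrix.ext fun h k => ?_))
    · simpa using congrArg (fun y : Unitization ℂ A => y.fst) (h1 1 1)
    · have h2 : m.left h (m.right k⁻¹ (c.snd.1 h k)) = 0 := by
        simpa using congrArg (fun y : Unitization ℂ A => y.snd) (h1 h k)
      have h3 := m.left_inv_left h (m.right k⁻¹ (c.snd.1 h k))
      have h4 := m.right_right_inv k (c.snd.1 h k)
      rw [h2, map_zero] at h3
      rw [← h3, map_zero] at h4
      exact h4.symm
  exists_j x z hx := by
    have hx' : ∀ h k, (x.1 h k).fst = if h = k then z else 0 := fun h k =>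
      (congrFun (congrFun (congrArg Subtype.val hx) h) k).trans Matrix.algebraMap_matrix_apply
    -- The preimage is obtained by conjugating the `A`-part of `x` back, entry by entry, to `ρ(h)⁻¹
    -- x(h, k) ρ(k)`.
    refine ⟨Unitization.inl z + Unitization.inr (⟨Matrix.of fun h k =>
      m.left h⁻¹ (m.right k (x.1 h k).snd), fun g h k => ?_⟩ : transMat G A), ?_⟩
    · simp only [Matrix.of_apply]
      rw [x.2 g h k, snd_unitization, m.act_eq, m.right_mul, ← m.left_right g, m.right_right_inv,
        ← m.left_right g, _root_.mul_inv_rev, m.left_mul, m.left_inv_left]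
    · refine Subtype.ext (Matrix.ext fun h k => ?_)
      rw [toInvMat_apply, ← Unitization.inl_fst_add_inr_snd_eq (x.1 h k), hx']
      simp [← m.left_right, m.left_left_inv, m.right_inv_right]

/-- The right-hand side involves only `G` and `A`, so any two implemented actions can be compared
through it. -/
theorem nonempty_equivariantK_equiv (m : MultiplierImplementation α) : Nonempty (EquivariantK α ≃+
    (KZero.map (augHom (transMat G A) : Unitization ℂ (transMat G A) →+* ℂ)).ker) := by
  obtain ⟨f⟩ := TwistedK.nonempty_equivariantK_equiv α
  obtain ⟨f'⟩ := m.excisionData.nonempty_ker_equiv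
  exact ⟨f.trans f'.symm⟩

/-- An action which is implemented by multipliers has the same equivariant `K`-group as the trivial
action. -/
theorem nonempty_equivariantK_equiv_trivial (m : MultiplierImplementation α) :
    Nonempty (EquivariantK α ≃+ EquivariantK (AlgAction.trivial G A)) := by
  obtain ⟨f⟩ := m.nonempty_equivariantK_equiv
  obtain ⟨f'⟩ := (trivial G A).nonempty_equivariantK_equiv
  exact ⟨f.trans f'.symm⟩

end MultiplierImplementation

end Inner

/-! ### The permutation action on sections -/

section Permutation

variable {H : Type v} [NormedAddCommGroup H] [InnerProductSpace ℂ H]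

/-- Left multiplication of compact operators by a bounded operator. -/
def CompactOp.leftMul (T : H →L[ℂ] H) : CompactOp H →ₗ[ℂ] CompactOp H where
  toFun k := ⟨T * k.1, IsCompactOperator.clm_comp k.2 T⟩
  map_add' k k' := Subtype.ext (mul_add T k.1 k'.1)
  map_smul' c k := Subtype.ext (mul_smul_comm c T k.1)

/-- Right multiplication of compact operators by a bounded operator. -/
def CompactOp.rightMul (T : H →L[ℂ] H) : CompactOp H →ₗ[ℂ] CompactOp H where
  toFun k := ⟨k.1 * T, IsCompactOperator.comp_clm k.2 T⟩
  map_add' k k' := Subtype.ext (add_mul k.1 k'.1 T)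
  map_smul' c k := Subtype.ext (smul_mul_assoc c k.1 T)

theorem CompactOp.continuous_leftMul (T : H →L[ℂ] H) : Continuous (CompactOp.leftMul T) :=
  Continuous.subtype_mk (f := fun k : compactOp H => T * k.1) (by fun_prop) _

theorem CompactOp.continuous_rightMul (T : H →L[ℂ] H) : Continuous (CompactOp.rightMul T) :=
  Continuous.subtype_mk (f := fun k : compactOp H => k.1 * T) (by fun_prop) _

variable [CompleteSpace H]

theorem CompactOp.act_leftMul {T : H →L[ℂ] H} {u : unitary (H →L[ℂ] H)}
    (h : (u : H →L[ℂ] H) * T = T * u) (k : CompactOp H) :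
    PU.act (PU.mk u) (leftMul T k) = leftMul T (PU.act (PU.mk u) k) :=
  Subtype.ext (by
    change (u : H →L[ℂ] H) * (T * k.1) * star (u : H →L[ℂ] H) = T * (u * k.1 * star _)
    simp only [← mul_assoc, h])

theorem CompactOp.act_rightMul {T : H →L[ℂ] H} {u : unitary (H →L[ℂ] H)}
    (h : star (u : H →L[ℂ] H) * T = T * star (u : H →L[ℂ] H)) (k : CompactOp H) :
    PU.act (PU.mk u) (rightMul T k) = rightMul T (PU.act (PU.mk u) k) :=
  Subtype.ext (by
    change (u : H →L[ℂ] H) * (k.1 * T) * star (u : H →L[ℂ] H) = u * k.1 * star _ * T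
    simp only [mul_assoc, h])

variable {X : Type u} [TopologicalSpace X]

/-- The fibrewise application to sections of a continuous linear map that commutes with the
transition functions. -/
def AlgBundle.sectionMap (𝒜 : AlgBundle.{u, v, w} X H) (f : CompactOp H →ₗ[ℂ] CompactOp H)
    (hf : Continuous f)
    (hg : ∀ i j x k, PU.act (𝒜.g j i x) (f k) = f (PU.act (𝒜.g j i x) k)) :
    𝒜.Sections →ₗ[ℂ] 𝒜.Sections where
  toFun s := ⟨fun i => ⟨fun x => f (s.1 i x), hf.comp (s.1 i).continuous⟩,
    fun i j x hi hj => (congrArg f (s.2 i j x hi hj)).trans (hg i j x _).symm⟩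
  map_add' _ _ := Subtype.ext <| funext fun _ => ContinuousMap.ext fun _ => map_add f _ _
  map_smul' c s := Subtype.ext <| funext fun i => ContinuousMap.ext fun x => map_smul f c (s.1 i x)

theorem AlgBundle.sections_ext {𝒜 : AlgBundle.{u, v, w} X H} {s t : 𝒜.Sections}
    (h : ∀ i x, (s.1 i x).1 = (t.1 i x).1) : s = t :=
  Subtype.ext <| funext fun i => ContinuousMap.ext fun x => Subtype.ext (h i x)

/-- Makes multiplication by a permutation operator compatible with the gluing of `𝒜^{⊗n}`.
Commutation of `ρ(σ)` with `u^{⊗n}` as operators, not merely up to a scalar, is what is used. -/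
theorem act_pow_leftMul (n : ℕ) (σ : Equiv.Perm (Fin n)) (p : PU H)
    (k : CompactOp (TensorPower H n)) :
    PU.act (PU.pow n p) (CompactOp.leftMul (permUnitary H n σ).1 k)
      = CompactOp.leftMul (permUnitary H n σ).1 (PU.act (PU.pow n p) k) := by
  obtain ⟨u, rfl⟩ := PU.mk_surjective p
  exact CompactOp.act_leftMul (congrArg Subtype.val (permUnitary_commute n σ u)).symm k

theorem act_pow_rightMul (n : ℕ) (σ : Equiv.Perm (Fin n)) (p : PU H)
    (k : CompactOp (TensorPower H n)) :
    PU.act (PU.pow n p) (CompactOp.rightMul (permUnitary H n σ).1 k)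
      = CompactOp.rightMul (permUnitary H n σ).1 (PU.act (PU.pow n p) k) := by
  obtain ⟨u, rfl⟩ := PU.mk_surjective p
  refine CompactOp.act_rightMul ?_ k
  -- On the right the adjoint of `u^{⊗n}` intervenes, and it is the tensor power of `u⁻¹`.
  have h := congrArg Subtype.val (permUnitary_commute n σ u⁻¹)
  rw [map_inv] at h
  exact h.symm

/-- The permutation action on sections is implemented by the permutation operators. -/
def permImplementation (𝒜 : AlgBundle.{u, v, w} X H) (n : ℕ) :
    MultiplierImplementation (𝒜.permAction n) where
  left σ := (𝒜.pow n).sectionMap (CompactOp.leftMul (permUnitary H n σ).1)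
    (CompactOp.continuous_leftMul _) fun i j x k => act_pow_leftMul n σ (𝒜.g j i x) k
  right σ := (𝒜.pow n).sectionMap (CompactOp.rightMul (permUnitary H n σ).1)
    (CompactOp.continuous_rightMul _) fun i j x k => act_pow_rightMul n σ (𝒜.g j i x) k
  left_one s := AlgBundle.sections_ext fun i x => by
    change (permUnitary H n 1).1 * (s.1 i x).1 = (s.1 i x).1
    rw [permUnitary_one]
    exact one_mul _
  right_one s := AlgBundle.sections_ext fun i x => by
    change (s.1 i x).1 * (permUnitary H n 1).1 = (s.1 i x).1
    rw [permUnitary_one]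
    exact mul_one _
  left_mul σ τ s := AlgBundle.sections_ext fun i x => by
    change (permUnitary H n (σ * τ)).1 * (s.1 i x).1
      = (permUnitary H n σ).1 * ((permUnitary H n τ).1 * (s.1 i x).1)
    rw [permUnitary_mul]
    exact mul_assoc _ _ _
  right_mul σ τ s := AlgBundle.sections_ext fun i x => by
    change (s.1 i x).1 * (permUnitary H n (σ * τ)).1
      = (s.1 i x).1 * (permUnitary H n σ).1 * (permUnitary H n τ).1
    rw [permUnitary_mul]
    exact (mul_assoc _ _ _).symm
  left_right σ τ s := AlgBundle.sections_ext fun i x => (mul_assoc _ _ _).symm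
  left_apply_mul σ s t := AlgBundle.sections_ext fun i x => (mul_assoc _ _ _).symm
  right_apply_mul σ s t := AlgBundle.sections_ext fun i x => mul_assoc _ _ _
  right_mul_eq σ s t := AlgBundle.sections_ext fun i x => mul_assoc _ _ _
  act_eq σ s := AlgBundle.sections_ext fun i x => by
    have h : permUnitary H n σ⁻¹ = (permUnitary H n σ)⁻¹ := by
      rw [eq_inv_iff_mul_eq_one, ← permUnitary_mul, inv_mul_cancel, permUnitary_one]
    change (permUnitary H n σ).1 * (s.1 i x).1 * star (permUnitary H n σ).1
      = (permUnitary H n σ).1 * ((s.1 i x).1 * (permUnitary H n σ⁻¹).1)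
    rw [h]
    exact mul_assoc _ _ _

variable (H) in
/-- The permutation representation, as a homomorphism. -/
def permRep (n : ℕ) :
    Equiv.Perm (Fin n) →* unitary (TensorPower H n →L[ℂ] TensorPower H n) where
  toFun := permUnitary H n
  map_one' := permUnitary_one
  map_mul' := permUnitary_mul

end Permutation

end
end TwistedK

/-! ### The theorem -/

theorem lemma7p2 {X : Type u} [TopologicalSpace X] [CompactSpace X]
    {H : Type v} [NormedAddCommGroup H] [InnerProductSpace ℂ H] [CompleteSpace H]
    (𝒜 : TwistedK.AlgBundle.{u, v, w} X H) (n : ℕ) :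
    Nonempty
      (TwistedK.EquivariantK (𝒜.permAction n) ≃+
        TwistedK.EquivariantK
          (TwistedK.AlgAction.trivial (Equiv.Perm (Fin n)) (𝒜.pow n).Sections)) ∧
    ∃ ρ : Equiv.Perm (Fin n) →*
        unitary (TwistedK.TensorPower H n →L[ℂ] TwistedK.TensorPower H n),
      (∀ σ, TwistedK.PU.mk (ρ σ) = TwistedK.permPU H n σ) ∧
      ∀ (σ : Equiv.Perm (Fin n)) (u : unitary (H →L[ℂ] H)),
        ρ σ * TwistedK.unitaryPow n u = TwistedK.unitaryPow n u * ρ σ :=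
  ⟨(TwistedK.permImplementation 𝒜 n).nonempty_equivariantK_equiv_trivial,
    TwistedK.permRep H n, fun _ => rfl, fun σ u => TwistedK.permUnitary_commute n σ u⟩
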